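/- Let $K>0$, $\gamma\in(6/5,2)$, $P(\rho)=K\rho^{\gamma}$, and let $\mu>0$. Let $\rho_\mu(|x|)$ be the non-rotating star with center density $\mu$: a continuous radial density on $\mathbf R^3$ with $\rho_\mu(0)=\mu$ and $\{\rho_\mu>0\}=\{|x|<R_\mu\}$ for some $0<R_\mu<\infty$, which together with its radial gravitational potential $V_\mu$ satisfies $$\nabla P(\rho_\mu)+\rho_\mu\nabla V_\mu=0,\qquad \Delta V_\mu=4\pi\rho_\mu,\qquad \lim_{|x|\to\infty}V_\mu(x)=0 .$$ Let $\Phi'(\rho)=\int_0^\rho \frac{P'(s)}{s}\,ds$, let $F_+:\mathbf R\to[0,\infty)$ be the inverse function of $\Phi'$ on $(0,\infty)$, extended by zero to $(-\infty,0]$, and let $$D_\mu^0=-\Delta_r-4\pi F_+'\big(V_\mu(R_\mu)-V_\mu(r)\big),\qquad \Delta_r=\frac{d^2}{dr^2}+\frac2r\frac{d}{dr},$$ be the linearized operator on radial functions. Then $n^-(D_\mu^0)=1$. That is: (i) the maximal dimension of a subspace of $\dot H^1_r(\mathbf R^3)$ (the radial functions in $\dot H^1(\mathbf R^3)$) on which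 the quadratic form $$\langle D_\mu^0\phi,\phi\rangle=\int_{\mathbf R^3}|\nabla\phi|^2\,dx-4\pi\int_{\mathbf R^3}F_+'\big(V_\mu(R_\mu)-V_\mu\big)\,\phi^2\,dx$$ is negative definite equals $1$; (ii) as an operator $H^2_r(\mathbf R^3)\to L^2_r(\mathbf R^3)$, $D_\mu^0$ has exactly one negative eigenvalue, and this eigenvalue is simple. -/

import Mathlib

open Set Filter Topology MeasureTheory

noncomputable section

namespace EulerPoisson

/-! ## Equations of state -/

/-- The polytropic equation of state `P(ρ) = K ρ ^ γ`. -/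
def polytrope (K γ : ℝ) : ℝ → ℝ := fun ρ => K * ρ ^ γ

/-- The derivative `Φ'` of the enthalpy, fixed by `Φ'(0) = 0` and `Φ''(ρ) = P'(ρ) / ρ`. -/
def enthalpyDeriv (P : ℝ → ℝ) (ρ : ℝ) : ℝ := ∫ s in (0 : ℝ)..ρ, deriv P s / s

/-- `F₊`: the inverse function of `Φ' : (0, ∞) → (0, s_max)` for positive arguments, extended
by zero to `(-∞, 0]`. -/
def Fplus (P : ℝ → ℝ) (s : ℝ) : ℝ :=
  if 0 < s then Function.invFunOn (enthalpyDeriv P) (Ioi 0) s else 0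

/-! ## Non-rotating stars -/

/-- The radial Laplacian `Δ_r = d²/dr² + (2/r) d/dr` of `ℝ³`. -/
def radialLaplacian (φ : ℝ → ℝ) (r : ℝ) : ℝ := deriv (deriv φ) r + 2 / r * deriv φ r

/-- `(ρ, V)` are the radial profiles (functions of `r = |x|`, only `r ≥ 0` matters) of the density
and of the gravitational potential of a non-rotating star, with pressure law `P`, center density
`μ` and support radius `R`: a static solution of the Euler-Poisson system whose density is
positive exactly in the ball `{|x| < R}`. -/
structure IsNonrotatingStar (P : ℝ → ℝ) (μ R : ℝ) (ρ V : ℝ → ℝ) : Prop where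
  radius_pos : 0 < R
  /-- the density is continuous -/
  continuousOn_density : ContinuousOn ρ (Ici 0)
  /-- the center density is `μ` -/
  center : ρ 0 = μ
  /-- `{ρ > 0}` is the ball of radius `R`, and `ρ` vanishes outside -/
  pos_of_lt : ∀ r, 0 ≤ r → r < R → 0 < ρ r
  eq_zero_of_le : ∀ r, R ≤ r → ρ r = 0
  /-- hydrostatic equilibrium `∇P(ρ) + ρ ∇V = 0` -/
  hydrostatic : ∀ r, 0 < r → HasDerivAt (fun s => P (ρ s)) (-(ρ r * deriv V r)) r
  /-- the potential is a twice differentiable function of `r > 0`, which is regular at the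
  origin of `ℝ³` -/
  continuousOn_potential : ContinuousOn V (Ici 0)
  differentiableAt_potential : ∀ r, 0 < r → DifferentiableAt ℝ V r
  differentiableAt_deriv_potential : ∀ r, 0 < r → DifferentiableAt ℝ (deriv V) r
  tendsto_deriv_potential_zero : Tendsto (deriv V) (𝓝[>] 0) (𝓝 0)
  /-- the Poisson equation `ΔV = 4πρ` -/
  poisson : ∀ r, 0 < r → radialLaplacian V r = 4 * Real.pi * ρ r
  /-- the potential vanishes at infinity -/
  tendsto_potential_atTop : Tendsto V atTop (𝓝 0)

/-! ## Radial function spaces -/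

/-- The radial function `f(|x|)` belongs to `L²(ℝ³)`, that is, `∫₀^∞ f(r)² r² dr < ∞`. -/
def IsRadialL2 (f : ℝ → ℝ) : Prop := MemLp (fun r => r * f r) 2 (volume.restrict (Ioi 0))

/-- `f` is locally absolutely continuous on `(0, ∞)`. -/
def IsLocallyAC (f : ℝ → ℝ) : Prop :=
  ∀ a b : ℝ, 0 < a → a ≤ b → AbsolutelyContinuousOnInterval f a b

theorem IsLocallyAC.ae_differentiableAt {f : ℝ → ℝ} (hf : IsLocallyAC f) :
    ∀ᵐ r ∂(volume.restrict (Ioi (0 : ℝ))), DifferentiableAt ℝ f r := by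
  rw [ae_restrict_iff' measurableSet_Ioi]
  have h : ∀ n : ℕ, ∀ᵐ r : ℝ, r ∈ uIcc (1 / ((n : ℝ) + 1)) ((n : ℝ) + 1) →
      DifferentiableAt ℝ f r := by
    intro n
    refine (hf _ _ (by positivity) ?_).ae_differentiableAt
    rw [div_le_iff₀ (by positivity)]
    nlinarith [(Nat.cast_nonneg n : (0 : ℝ) ≤ n)]
  filter_upwards [ae_all_iff.2 h] with r hr hr0
  have hr0' : (0 : ℝ) < r := hr0
  obtain ⟨n, hn⟩ := exists_nat_gt (max r (1 / r))
  have h1 : r < n := lt_of_le_of_lt (le_max_left _ _) hn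
  have h2 : 1 / r < n := lt_of_le_of_lt (le_max_right _ _) hn
  refine hr n ?_
  rw [mem_uIcc]
  left
  refine ⟨?_, by linarith⟩
  rw [div_le_iff₀ (by positivity)]
  rw [div_lt_iff₀ hr0'] at h2
  nlinarith

/-- The space `Ḣ¹_r` of radial functions in `Ḣ¹(ℝ³)` (the functions with gradient in `L²` that
vanish at infinity), as functions `φ(r)` of the radius: `φ` is locally absolutely continuous on
`(0, ∞)`, `φ'` is square integrable against `r² dr` and `φ(r) → 0` as `r → ∞`. Only the values for
`r > 0` matter; those for `r ≤ 0` are normalized to be zero. -/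
def radialHDot1 : Submodule ℝ (ℝ → ℝ) where
  carrier := {φ | (∀ r ≤ 0, φ r = 0) ∧ IsLocallyAC φ ∧ IsRadialL2 (deriv φ) ∧
    Tendsto φ atTop (𝓝 0)}
  zero_mem' := by
    refine ⟨fun _ _ => rfl, fun a b _ _ => ?_, ?_, tendsto_const_nhds⟩
    · simp [AbsolutelyContinuousOnInterval, tendsto_const_nhds]
    · have h : deriv (0 : ℝ → ℝ) = 0 := by
        funext r
        exact deriv_const r (0 : ℝ)
      simp [IsRadialL2, h]
  add_mem' := by
    rintro φ ψ ⟨h1, h2, h3, h4⟩ ⟨k1, k2, k3, k4⟩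
    refine ⟨fun r hr => by simp [h1 r hr, k1 r hr], fun a b ha hab => ?_, ?_, ?_⟩
    · exact (h2 a b ha hab).add (k2 a b ha hab)
    · refine (MemLp.add h3 k3).ae_eq ?_
      filter_upwards [h2.ae_differentiableAt, k2.ae_differentiableAt] with r hr kr
      simp only [Pi.add_apply]
      rw [deriv_add hr kr]
      ring
    · have h := h4.add k4
      rw [add_zero] at h
      exact h
  smul_mem' := by
    rintro c φ ⟨h1, h2, h3, h4⟩
    refine ⟨fun r hr => by simp [h1 r hr], fun a b ha hab => ?_, ?_, ?_⟩
    · exact (h2 a b ha hab).const_mul c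
    · refine (MemLp.const_mul h3 c).ae_eq ?_
      filter_upwards [h2.ae_differentiableAt] with r hr
      rw [deriv_const_smul c hr]
      simp only [smul_eq_mul]
      ring
    · have h := h4.const_mul c
      rw [mul_zero] at h
      exact h

/-- `φ` belongs to the space `H²_r` of radial functions in `H²(ℝ³)`, as a function of the radius:
`φ` is differentiable with locally absolutely continuous derivative on `(0, ∞)`, and `φ`, its
gradient `φ'` and the entries `φ''`, `φ' / r` of its Hessian are square integrable on `ℝ³`. The
values for `r ≤ 0` are normalized to be zero. -/
structure IsRadialH2 (φ : ℝ → ℝ) : Prop where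
  eq_zero : ∀ r ≤ 0, φ r = 0
  differentiableAt : ∀ r, 0 < r → DifferentiableAt ℝ φ r
  locallyAC_deriv : IsLocallyAC (deriv φ)
  memL2 : IsRadialL2 φ
  memL2_deriv : IsRadialL2 (deriv φ)
  memL2_deriv_div : IsRadialL2 (fun r => deriv φ r / r)
  memL2_deriv_deriv : IsRadialL2 (deriv (deriv φ))

/-! ## The operator `D_μ⁰` -/

/-- The potential `4π F₊'(V(R) - V(r))` of the linearized radial operator. -/
def linPotential (P : ℝ → ℝ) (R : ℝ) (V : ℝ → ℝ) (r : ℝ) : ℝ :=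
  4 * Real.pi * deriv (Fplus P) (V R - V r)

/-- The linearized radial operator `D⁰ φ = -Δ_r φ - 4π F₊'(V(R) - V(r)) φ`. -/
def linOp (P : ℝ → ℝ) (R : ℝ) (V φ : ℝ → ℝ) (r : ℝ) : ℝ :=
  -radialLaplacian φ r - linPotential P R V r * φ r

/-- The quadratic form `⟨D⁰ φ, φ⟩ = ∫_{ℝ³} |∇φ|² dx - 4π ∫_{ℝ³} F₊'(V(R) - V) φ² dx` of the
linearized radial operator, in polar coordinates (`dx = 4π r² dr`). -/
def linForm (P : ℝ → ℝ) (R : ℝ) (V φ : ℝ → ℝ) : ℝ :=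
  4 * Real.pi * (∫ r in Ioi (0 : ℝ), r ^ 2 * deriv φ r ^ 2) -
    4 * Real.pi * (∫ r in Ioi (0 : ℝ), r ^ 2 * (linPotential P R V r * φ r ^ 2))

/-- The negative index `n⁻(Q)` of a quadratic form `Q` on the space `X`: the maximal dimension of
a subspace of `X` on which `Q` is negative definite. -/
def negIndex {E : Type*} [AddCommGroup E] [Module ℝ E] (X : Submodule ℝ E) (Q : E → ℝ) : ℕ∞ :=
  sSup {d | ∃ N : Submodule ℝ E, N ≤ X ∧ (∀ v ∈ N, v ≠ 0 → Q v < 0) ∧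
    d = Cardinal.toENat (Module.rank ℝ N)}

/-- `φ` is an eigenfunction for the eigenvalue `lam` of `D⁰`, as an operator from `H²_r`
to `L²_r`. -/
def IsEigenfunction (P : ℝ → ℝ) (R : ℝ) (V : ℝ → ℝ) (lam : ℝ) (φ : ℝ → ℝ) : Prop :=
  IsRadialH2 φ ∧ φ ≠ 0 ∧
    ∀ᵐ r ∂(volume.restrict (Ioi (0 : ℝ))), linOp P R V φ r = lam * φ r

end EulerPoisson

end

/-!
Write `α = 1 / (γ - 1)`, so that `1 < α < 5`. Inside a polytropic star the enthalpy is
`V(R) - V`, and therefore `y = V(R) - V` solves the Lane-Emden equation `-Δ y = C y₊ ^ α`. The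
linearized operator is `-Δ - q` with `q = C α y₊ ^ (α - 1)`, a continuous potential supported in
the ball of radius `R`.

The Lane-Emden equation is invariant under `y ↦ t ^ (2 / (α - 1)) y(t ·)`, so the generator
`w = r y' + 2 / (α - 1) y` of this scaling solves `-Δ w - q w = 0`. It is positive at the origin
and negative beyond `R`. Since `w = y (2 / (α - 1) - v)` with `v = -r y' / y` and, by Pohozaev's
identity for the subcritical exponent `α < 5`, `v` is strictly increasing inside the star
(`IsEmdenProfile.strictMonoOn_logDeriv`), `w` has exactly one zero `r₀`
(`IsEmdenProfile.exists_emdenScaling_zero`).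

At most one negative direction: by Picone's identity with the comparison function `w` on `(0, r₀)`
and `(r₀, ∞)`, the form is nonnegative on the functions that vanish at `r₀`, a subspace of
codimension one (`integral_potential_le_of_apply_eq_zero`). Two independent eigenfunctions
with negative eigenvalues would have a combination that vanishes at `r₀` and makes the form
negative, which gives the uniqueness and simplicity of the negative eigenvalue
(`eigenfunction_unique`).

At least one: let `u'' = (κ² - q) u` on `[0, R]` with `u(0) = 0` and fixed `u'(0) > 0`. The shooting
function `u'(R) + κ u(R)` is continuous in `κ`, is nonnegative for large `κ`, and is negative
for `κ = 0`, where `u = r w`. At a zero of it, `u` is continued by `exp (-κ r)` and `u / r` is an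
eigenfunction in `H²_r` for the eigenvalue `-κ²` (`IsRegularSolution.exists_matching`,
`IsEmdenProfile.exists_eigenfunction`). It also spans a line on which the form is negative.
-/

noncomputable section

namespace EulerPoisson

/-! ### The polytropic enthalpy -/

theorem deriv_polytrope (K γ s : ℝ) :
    deriv (polytrope K γ) s = K * (γ * s ^ (γ - 1)) := by
  unfold polytrope
  rw [deriv_const_mul_field, Real.deriv_rpow_const]

theorem enthalpyDeriv_polytrope (K : ℝ) {γ : ℝ} (hγ : 1 < γ) {ρ : ℝ} (hρ : 0 ≤ ρ) :
    enthalpyDeriv (polytrope K γ) ρ = K * γ / (γ - 1) * ρ ^ (γ - 1) := by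
  unfold enthalpyDeriv
  have h1 : ∫ s in (0 : ℝ)..ρ, deriv (polytrope K γ) s / s =
      ∫ s in (0 : ℝ)..ρ, K * γ * s ^ (γ - 2) := by
    refine intervalIntegral.integral_congr_ae (ae_of_all _ fun s hs => ?_)
    rw [uIoc_of_le hρ] at hs
    rw [deriv_polytrope, show γ - 1 = (γ - 2) + 1 by ring, Real.rpow_add_one hs.1.ne']
    field_simp [hs.1.ne']
  rw [h1, intervalIntegral.integral_const_mul, integral_rpow (Or.inl (by linarith)),
    show γ - 2 + 1 = γ - 1 by ring, Real.zero_rpow (by linarith)]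
  field_simp
  ring

/-- The coefficient `c` in `F₊(s) = c s₊ ^ (1 / (γ - 1))`. -/
def fplusCoeff (K γ : ℝ) : ℝ := ((γ - 1) / (K * γ)) ^ (1 / (γ - 1))

theorem fplusCoeff_pos {K γ : ℝ} (hK : 0 < K) (hγ : 1 < γ) : 0 < fplusCoeff K γ :=
  Real.rpow_pos_of_pos (div_pos (by linarith) (by nlinarith)) _

theorem eq_fplusCoeff_mul_rpow {K γ ρ s : ℝ} (hK : 0 < K) (hγ : 1 < γ) (hρ : 0 ≤ ρ)
    (h : K * γ / (γ - 1) * ρ ^ (γ - 1) = s) : ρ = fplusCoeff K γ * s ^ (1 / (γ - 1)) := by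
  have hγ' : 0 < γ - 1 := by linarith
  have h0 : 0 ≤ ρ ^ (γ - 1) := Real.rpow_nonneg hρ _
  have hs : 0 ≤ s := by rw [← h]; positivity
  unfold fplusCoeff
  rw [← Real.mul_rpow (by positivity) hs, ← h,
    show (γ - 1) / (K * γ) * (K * γ / (γ - 1) * ρ ^ (γ - 1)) = ρ ^ (γ - 1) by field_simp,
    ← Real.rpow_mul hρ, mul_one_div_cancel hγ'.ne', Real.rpow_one]

theorem enthalpy_fplusCoeff_mul_rpow {K γ s : ℝ} (hK : 0 < K) (hγ : 1 < γ) (hs : 0 ≤ s) :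
    K * γ / (γ - 1) * (fplusCoeff K γ * s ^ (1 / (γ - 1))) ^ (γ - 1) = s := by
  have hγ' : 0 < γ - 1 := by linarith
  unfold fplusCoeff
  rw [← Real.mul_rpow (by positivity) hs, ← Real.rpow_mul (by positivity),
    one_div_mul_cancel hγ'.ne', Real.rpow_one]
  field_simp

theorem Fplus_polytrope {K γ : ℝ} (hK : 0 < K) (hγ : 1 < γ) (s : ℝ) :
    Fplus (polytrope K γ) s = fplusCoeff K γ * (max s 0) ^ (1 / (γ - 1)) := by
  have hγ' : 0 < γ - 1 := by linarith
  unfold Fplus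
  split_ifs with hs
  · have hmem : ∃ ρ ∈ Ioi (0 : ℝ), enthalpyDeriv (polytrope K γ) ρ = s := by
      have hpos : 0 < fplusCoeff K γ * s ^ (1 / (γ - 1)) :=
        mul_pos (fplusCoeff_pos hK hγ) (Real.rpow_pos_of_pos hs _)
      refine ⟨_, hpos, ?_⟩
      rw [enthalpyDeriv_polytrope K hγ hpos.le, enthalpy_fplusCoeff_mul_rpow hK hγ hs.le]
    have h1 := Function.invFunOn_mem hmem
    have h2 := Function.invFunOn_eq hmem
    rw [enthalpyDeriv_polytrope K hγ (le_of_lt h1)] at h2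
    rw [max_eq_left hs.le]
    exact eq_fplusCoeff_mul_rpow hK hγ (le_of_lt h1) h2
  · rw [max_eq_right (not_lt.1 hs), Real.zero_rpow (by positivity), mul_zero]

/-- The positive part power `s₊ ^ α` is continuously differentiable for `α > 1`. -/
theorem hasDerivAt_max_rpow {α : ℝ} (hα : 1 < α) (s : ℝ) :
    HasDerivAt (fun t : ℝ => (max t 0) ^ α) (α * (max s 0) ^ (α - 1)) s := by
  have hneg : HasDerivWithinAt (fun t : ℝ => (max t 0) ^ α) 0 (Iic 0) (min s 0) := by
    refine (hasDerivWithinAt_const (min s 0) (Iic 0) (0 : ℝ)).congr_of_mem ?_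
      (mem_Iic.2 (min_le_right _ _))
    intro t ht
    rw [max_eq_right ht, Real.zero_rpow (by linarith)]
  have hposd : HasDerivAt (fun t : ℝ => t ^ α) (α * (max s 0) ^ (α - 1)) (max s 0) :=
    Real.hasDerivAt_rpow_const (Or.inr hα.le)
  rcases lt_trichotomy s 0 with hs | rfl | hs
  · rw [min_eq_left hs.le] at hneg
    rw [max_eq_right hs.le, Real.zero_rpow (by linarith), mul_zero]
    exact hneg.hasDerivAt (Iic_mem_nhds hs)
  · rw [min_self] at hneg
    rw [max_self, Real.zero_rpow (by linarith), mul_zero] at hposd ⊢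
    have h2 : HasDerivWithinAt (fun t : ℝ => (max t 0) ^ α) 0 (Ici 0) 0 := by
      refine hposd.hasDerivWithinAt.congr_of_mem ?_ (mem_Ici.2 le_rfl)
      intro t ht
      rw [max_eq_left ht]
    have := hneg.union h2
    rwa [Iic_union_Ici, hasDerivWithinAt_univ] at this
  · rw [max_eq_left hs.le] at hposd ⊢
    refine hposd.congr_of_eventuallyEq ?_
    filter_upwards [Ioi_mem_nhds hs] with t ht
    rw [max_eq_left (le_of_lt ht)]

theorem deriv_Fplus_polytrope {K γ : ℝ} (hK : 0 < K) (hγ : γ ∈ Ioo (1 : ℝ) 2) (s : ℝ) :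
    deriv (Fplus (polytrope K γ)) s =
      fplusCoeff K γ * (1 / (γ - 1) * (max s 0) ^ (1 / (γ - 1) - 1)) := by
  have hα : 1 < 1 / (γ - 1) := by
    rw [lt_div_iff₀ (by linarith [hγ.1])]
    linarith [hγ.2]
  rw [show Fplus (polytrope K γ) = fun s => fplusCoeff K γ * (max s 0) ^ (1 / (γ - 1)) from
    funext (Fplus_polytrope hK hγ.1)]
  exact ((hasDerivAt_max_rpow hα s).const_mul _).deriv

/-! ### The Lane-Emden equation -/

/-- `y` is the radial profile of a solution of the Lane-Emden equation `-Δ y = C y₊ ^ α` on `ℝ³`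
which is regular at the origin, positive exactly on the ball of radius `R` and decreasing, with
`z = y'` and with the subcritical exponents `1 < α < 5`. -/
structure IsEmdenProfile (C α R : ℝ) (y z : ℝ → ℝ) : Prop where
  coeff_pos : 0 < C
  one_lt : 1 < α
  lt_five : α < 5
  radius_pos : 0 < R
  continuousOn : ContinuousOn y (Ici 0)
  hasDerivAt : ∀ r, 0 < r → HasDerivAt y (z r) r
  hasDerivAt_deriv : ∀ r, 0 < r → HasDerivAt z (-(2 / r * z r) - C * (max (y r) 0) ^ α) r
  tendsto_deriv_zero : Tendsto z (𝓝[>] 0) (𝓝 0)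
  pos_of_lt : ∀ r, 0 ≤ r → r < R → 0 < y r
  nonpos_of_le : ∀ r, R ≤ r → y r ≤ 0
  deriv_neg : ∀ r, 0 < r → z r < 0

namespace IsNonrotatingStar

variable {P : ℝ → ℝ} {μ R : ℝ} {ρ V : ℝ → ℝ}

theorem density_nonneg (h : IsNonrotatingStar P μ R ρ V) {r : ℝ} (hr : 0 ≤ r) : 0 ≤ ρ r := by
  rcases lt_or_ge r R with h1 | h1
  · exact (h.pos_of_lt r hr h1).le
  · exact (h.eq_zero_of_le r h1).ge

theorem hasDerivAt_deriv_potential (h : IsNonrotatingStar P μ R ρ V) {r : ℝ} (hr : 0 < r) :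
    HasDerivAt (deriv V) (4 * Real.pi * ρ r - 2 / r * deriv V r) r := by
  have h1 := (h.differentiableAt_deriv_potential r hr).hasDerivAt
  have h2 := h.poisson r hr
  unfold radialLaplacian at h2
  rwa [show deriv (deriv V) r = 4 * Real.pi * ρ r - 2 / r * deriv V r by linarith] at h1

/-- The gravitational force points inward: `r² V'` vanishes at the origin and has the derivative
`4π r² ρ`. -/
theorem deriv_potential_pos (h : IsNonrotatingStar P μ R ρ V) {r : ℝ} (hr : 0 < r) :
    0 < deriv V r := by
  set m : ℝ → ℝ := fun r => if r ≤ 0 then 0 else r ^ 2 * deriv V r with hm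
  have hmpos : ∀ r, 0 < r → m r = r ^ 2 * deriv V r := fun r hr => by simp [hm, not_le.2 hr]
  have hd : ∀ r, 0 < r → HasDerivAt m (4 * Real.pi * r ^ 2 * ρ r) r := by
    intro r hr
    have h1 := ((hasDerivAt_id r).pow 2).mul (h.hasDerivAt_deriv_potential hr)
    refine (h1.congr_of_eventuallyEq ?_).congr_deriv ?_
    · filter_upwards [Ioi_mem_nhds hr] with s hs
      rw [hmpos s hs]
      rfl
    · simp
      field_simp
      ring
  have h0 : ContinuousWithinAt m (Ici 0) 0 := by
    have h1 : Tendsto (fun r : ℝ => r ^ 2 * deriv V r) (𝓝[>] 0) (𝓝 (0 ^ 2 * 0)) :=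
      (tendsto_nhdsWithin_of_tendsto_nhds ((continuous_pow 2).tendsto 0)).mul
        h.tendsto_deriv_potential_zero
    rw [← continuousWithinAt_Ioi_iff_Ici]
    have h2 : m 0 = 0 := by simp [hm]
    unfold ContinuousWithinAt
    rw [h2]
    simp only [mul_zero] at h1
    refine h1.congr' ?_
    filter_upwards [self_mem_nhdsWithin] with s hs
    rw [hmpos s hs]
  have hcont : ContinuousOn m (Ici 0) := by
    intro r hr
    rcases eq_or_lt_of_le (mem_Ici.1 hr) with rfl | hr'
    · exact h0
    · exact (hd r hr').continuousAt.continuousWithinAt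
  have hmono : MonotoneOn m (Ici 0) := by
    refine monotoneOn_of_deriv_nonneg (convex_Ici 0) hcont ?_ ?_
    · intro r hr
      rw [interior_Ici] at hr
      exact (hd r hr).differentiableAt.differentiableWithinAt
    · intro r hr
      rw [interior_Ici] at hr
      rw [(hd r hr).deriv]
      have := h.density_nonneg (le_of_lt hr)
      positivity
  have hstrict : StrictMonoOn m (Icc 0 R) := by
    refine strictMonoOn_of_deriv_pos (convex_Icc 0 R) (hcont.mono Icc_subset_Ici_self) ?_
    intro r hr
    rw [interior_Icc] at hr
    rw [(hd r hr.1).deriv]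
    have h1 := h.pos_of_lt r hr.1.le hr.2
    have h2 := hr.1
    positivity
  have hkey : 0 < m r := by
    have hR := h.radius_pos
    have h1 : m 0 < m (min r R) :=
      hstrict (left_mem_Icc.2 hR.le) ⟨(lt_min hr hR).le, min_le_right _ _⟩ (lt_min hr hR)
    have h2 : m (min r R) ≤ m r :=
      hmono (mem_Ici.2 (lt_min hr hR).le) (mem_Ici.2 hr.le) (min_le_left _ _)
    have h3 : m 0 = 0 := by simp [hm]
    linarith
  rw [hmpos r hr] at hkey
  exact pos_of_mul_pos_right hkey (sq_nonneg r)

theorem strictMonoOn_potential (h : IsNonrotatingStar P μ R ρ V) : StrictMonoOn V (Ici 0) := by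
  refine strictMonoOn_of_deriv_pos (convex_Ici 0) h.continuousOn_potential ?_
  intro r hr
  rw [interior_Ici] at hr
  exact h.deriv_potential_pos hr

/-- Hydrostatic equilibrium in integrated form: inside the star, the enthalpy `Φ'(ρ)` equals
`V(R) - V`. -/
theorem enthalpy_eq {K γ : ℝ} (hK : 0 < K) (hγ : 1 < γ)
    (h : IsNonrotatingStar (polytrope K γ) μ R ρ V) {r : ℝ} (hr : r ∈ Icc 0 R) :
    K * γ / (γ - 1) * ρ r ^ (γ - 1) = V R - V r := by
  have hR := h.radius_pos
  set F : ℝ → ℝ := fun r => K * γ / (γ - 1) * ρ r ^ (γ - 1) + V r with hF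
  have hcont : ContinuousOn F (Icc 0 R) := by
    refine ContinuousOn.add (ContinuousOn.mul continuousOn_const ?_)
      (h.continuousOn_potential.mono Icc_subset_Ici_self)
    exact (h.continuousOn_density.mono Icc_subset_Ici_self).rpow_const
      fun x _ => Or.inr (by linarith)
  have hd : ∀ x ∈ Ioo 0 R, HasDerivAt F 0 x := by
    intro x hx
    have hρ := h.pos_of_lt x hx.1.le hx.2
    have h1 := h.hydrostatic x hx.1
    -- near `x`, the enthalpy is a smooth function of the pressure
    have h2 := ((h1.div_const K).rpow_const (p := (γ - 1) / γ)
      (Or.inl (by unfold polytrope; positivity))).const_mul (K * γ / (γ - 1))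
    have h3 := h2.add (h.differentiableAt_potential x hx.1).hasDerivAt
    have hpow : ∀ s, 0 < ρ s → (polytrope K γ (ρ s) / K) = ρ s ^ γ := fun s _ => by
      unfold polytrope; field_simp
    refine (h3.congr_of_eventuallyEq ?_).congr_deriv ?_
    · filter_upwards [Ioo_mem_nhds hx.1 hx.2] with s hs
      have hs' := h.pos_of_lt s hs.1.le hs.2
      simp only [hF, Pi.add_apply]
      rw [hpow s hs', ← Real.rpow_mul hs'.le, show γ * ((γ - 1) / γ) = γ - 1 by field_simp]
    · rw [hpow x hρ, ← Real.rpow_mul hρ.le, show γ * ((γ - 1) / γ - 1) = -1 by field_simp; ring,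
        Real.rpow_neg_one]
      have : γ - 1 ≠ 0 := by linarith
      field_simp
      ring
  have hconst : F r = F R := by
    rcases eq_or_lt_of_le hr.2 with rfl | hrR
    · rfl
    · obtain ⟨c, hc, hc'⟩ := exists_hasDerivAt_eq_slope F (fun _ => 0) hrR
        (hcont.mono (Icc_subset_Icc_left hr.1)) fun x hx => hd x ⟨hr.1.trans_lt hx.1, hx.2⟩
      rw [eq_comm, div_eq_zero_iff] at hc'
      rcases hc' with h1 | h1 <;> linarith
  have hRz : ρ R = 0 := h.eq_zero_of_le R le_rfl
  simp only [hF] at hconst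
  rw [hRz, Real.zero_rpow (by linarith)] at hconst
  linarith

/-- The potential of a polytropic star, measured from its value at the boundary, solves a
Lane-Emden equation. -/
theorem isEmdenProfile {K γ : ℝ} (hK : 0 < K) (hγ : γ ∈ Ioo (6 / 5 : ℝ) 2)
    (h : IsNonrotatingStar (polytrope K γ) μ R ρ V) :
    IsEmdenProfile (4 * Real.pi * fplusCoeff K γ) (1 / (γ - 1)) R (fun r => V R - V r)
      (fun r => -deriv V r) := by
  have hγ1 : 1 < γ := by linarith [hγ.1]
  have hα : 0 < 1 / (γ - 1) := by
    have : 0 < γ - 1 := by linarith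
    positivity
  have hR := h.radius_pos
  have hmono := h.strictMonoOn_potential
  have hle : ∀ r, R ≤ r → V R - V r ≤ 0 := fun r hr => by
    have := hmono.monotoneOn (mem_Ici.2 hR.le) (mem_Ici.2 (hR.le.trans hr)) hr
    linarith
  have hρ : ∀ r, 0 < r → ρ r = fplusCoeff K γ * (max (V R - V r) 0) ^ (1 / (γ - 1)) := by
    intro r hr
    rcases le_or_gt r R with h1 | h1
    · have h2 : 0 ≤ V R - V r := by
        have := hmono.monotoneOn (mem_Ici.2 hr.le) (mem_Ici.2 hR.le) h1
        linarith
      rw [max_eq_left h2]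
      exact eq_fplusCoeff_mul_rpow hK hγ1 (h.density_nonneg hr.le)
        (h.enthalpy_eq hK hγ1 ⟨hr.le, h1⟩)
    · rw [max_eq_right (hle r h1.le), Real.zero_rpow hα.ne', mul_zero, h.eq_zero_of_le r h1.le]
  refine
    { coeff_pos := mul_pos (by positivity) (fplusCoeff_pos hK hγ1)
      one_lt := ?_
      lt_five := ?_
      radius_pos := hR
      continuousOn := continuousOn_const.sub h.continuousOn_potential
      hasDerivAt := fun r hr => ?_
      hasDerivAt_deriv := fun r hr => ?_
      tendsto_deriv_zero := by simpa using h.tendsto_deriv_potential_zero.neg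
      pos_of_lt := fun r h0 h1 => ?_
      nonpos_of_le := hle
      deriv_neg := fun r hr => neg_neg_of_pos (h.deriv_potential_pos hr) }
  · rw [lt_div_iff₀ (by linarith)]
    linarith [hγ.2]
  · rw [div_lt_iff₀ (by linarith)]
    linarith [hγ.1]
  · exact (h.differentiableAt_potential r hr).hasDerivAt.const_sub _
  · refine (h.hasDerivAt_deriv_potential hr).neg.congr_deriv ?_
    rw [hρ r hr]
    ring
  · have := hmono (mem_Ici.2 h0) (mem_Ici.2 hR.le) h1
    linarith

end IsNonrotatingStar

/-! ### The scaling solution of the linearized Lane-Emden equation -/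

/-- The potential `C α y₊ ^ (α - 1)` of the linearized Lane-Emden equation. -/
def emdenPotential (C α : ℝ) (y : ℝ → ℝ) (r : ℝ) : ℝ := C * (α * (max (y r) 0) ^ (α - 1))

/-- The generator `r y' + 2 / (α - 1) y` of the scaling symmetry
`y ↦ t ^ (2 / (α - 1)) y(t ·)` of the Lane-Emden equation. -/
def emdenScaling (α : ℝ) (y z : ℝ → ℝ) (r : ℝ) : ℝ := r * z r + 2 / (α - 1) * y r

/-- The flux `r² w'` of the scaling generator `w`. -/
def emdenFlux (C α : ℝ) (y z : ℝ → ℝ) (r : ℝ) : ℝ :=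
  (2 / (α - 1) - 1) * (r ^ 2 * z r) - C * (r ^ 3 * (max (y r) 0) ^ α)

theorem tendsto_id_nhdsGT_zero : Tendsto (fun r : ℝ => r) (𝓝[>] 0) (𝓝 0) :=
  tendsto_nhdsWithin_of_tendsto_nhds tendsto_id

namespace IsEmdenProfile

variable {C α R : ℝ} {y z : ℝ → ℝ}

theorem apply_radius (h : IsEmdenProfile C α R y z) : y R = 0 := by
  have hR := h.radius_pos
  refine le_antisymm (h.nonpos_of_le R le_rfl) ?_
  have h1 : Tendsto y (𝓝[<] R) (𝓝 (y R)) :=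
    tendsto_nhdsWithin_of_tendsto_nhds (h.hasDerivAt R hR).continuousAt
  refine ge_of_tendsto h1 ?_
  filter_upwards [Ioo_mem_nhdsLT hR] with s hs
  exact (h.pos_of_lt s hs.1.le hs.2).le

theorem strictAntiOn (h : IsEmdenProfile C α R y z) : StrictAntiOn y (Ici 0) := by
  refine strictAntiOn_of_deriv_neg (convex_Ici 0) h.continuousOn ?_
  intro r hr
  rw [interior_Ici] at hr
  rw [(h.hasDerivAt r hr).deriv]
  exact h.deriv_neg r hr

theorem max_rpow_sub_one_mul (h : IsEmdenProfile C α R y z) (r : ℝ) :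
    (max (y r) 0) ^ (α - 1) * y r = (max (y r) 0) ^ α := by
  have hα := h.one_lt
  rcases le_or_gt (y r) 0 with h1 | h1
  · rw [max_eq_right h1, Real.zero_rpow (by linarith), Real.zero_rpow (by linarith), zero_mul]
  · rw [max_eq_left h1.le, ← Real.rpow_add_one h1.ne', sub_add_cancel]

theorem continuousOn_max_rpow (h : IsEmdenProfile C α R y z) {β : ℝ} (hβ : 0 ≤ β) :
    ContinuousOn (fun r => (max (y r) 0) ^ β) (Ici 0) :=
  (ContinuousOn.sup h.continuousOn continuousOn_const).rpow_const fun _ _ => Or.inr hβ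

theorem continuousOn_emdenPotential (h : IsEmdenProfile C α R y z) :
    ContinuousOn (emdenPotential C α y) (Ici 0) :=
  continuousOn_const.mul (continuousOn_const.mul
    (h.continuousOn_max_rpow (by linarith [h.one_lt])))

theorem emdenPotential_eq_zero (h : IsEmdenProfile C α R y z) {r : ℝ} (hr : R ≤ r) :
    emdenPotential C α y r = 0 := by
  unfold emdenPotential
  rw [max_eq_right (h.nonpos_of_le r hr), Real.zero_rpow (by linarith [h.one_lt])]
  ring

theorem hasDerivAt_emdenScaling (h : IsEmdenProfile C α R y z) {r : ℝ} (hr : 0 < r) :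
    HasDerivAt (emdenScaling α y z) (emdenFlux C α y z r / r ^ 2) r := by
  refine (((hasDerivAt_id r).mul (h.hasDerivAt_deriv r hr)).add
    ((h.hasDerivAt r hr).const_mul (2 / (α - 1)))).congr_deriv ?_
  unfold emdenFlux
  simp only [id]
  field_simp
  ring

theorem hasDerivAt_sq_mul_deriv (h : IsEmdenProfile C α R y z) {r : ℝ} (hr : 0 < r) :
    HasDerivAt (fun r => r ^ 2 * z r) (-(C * (r ^ 2 * (max (y r) 0) ^ α))) r := by
  refine (((hasDerivAt_id r).pow 2).mul (h.hasDerivAt_deriv r hr)).congr_deriv ?_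
  simp
  field_simp
  ring

theorem hasDerivAt_max_rpow_comp (h : IsEmdenProfile C α R y z) {r : ℝ} (hr : 0 < r) :
    HasDerivAt (fun r => (max (y r) 0) ^ α) (α * (max (y r) 0) ^ (α - 1) * z r) r :=
  (hasDerivAt_max_rpow h.one_lt (y r)).comp r (h.hasDerivAt r hr)

/-- The scaling generator solves the linearized Lane-Emden equation. -/
theorem hasDerivAt_emdenFlux (h : IsEmdenProfile C α R y z) {r : ℝ} (hr : 0 < r) :
    HasDerivAt (emdenFlux C α y z)
      (-(emdenPotential C α y r * r ^ 2 * emdenScaling α y z r)) r := by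
  have hα : α - 1 ≠ 0 := by linarith [h.one_lt]
  refine (((h.hasDerivAt_sq_mul_deriv hr).const_mul (2 / (α - 1) - 1)).sub
    ((((hasDerivAt_id r).pow 3).mul (h.hasDerivAt_max_rpow_comp hr)).const_mul C)).congr_deriv ?_
  unfold emdenPotential emdenScaling
  rw [← h.max_rpow_sub_one_mul r]
  simp
  field_simp
  ring

theorem continuousOn_emdenScaling (h : IsEmdenProfile C α R y z) :
    ContinuousOn (emdenScaling α y z) (Ioi 0) := fun _ hr =>
  (h.hasDerivAt_emdenScaling hr).continuousAt.continuousWithinAt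

theorem tendsto_nhdsGT_zero (h : IsEmdenProfile C α R y z) : Tendsto y (𝓝[>] 0) (𝓝 (y 0)) :=
  (h.continuousOn 0 self_mem_Ici).mono Ioi_subset_Ici_self

theorem tendsto_emdenScaling (h : IsEmdenProfile C α R y z) :
    Tendsto (emdenScaling α y z) (𝓝[>] 0) (𝓝 (2 / (α - 1) * y 0)) := by
  have h1 := (tendsto_id_nhdsGT_zero.mul h.tendsto_deriv_zero).add
    (h.tendsto_nhdsGT_zero.const_mul (2 / (α - 1)))
  rw [zero_mul, zero_add] at h1
  exact h1

theorem tendsto_emdenFlux_div (h : IsEmdenProfile C α R y z) :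
    Tendsto (fun r => emdenFlux C α y z r / r) (𝓝[>] 0) (𝓝 0) := by
  have h1 : Tendsto (fun r => (max (y r) 0) ^ α) (𝓝[>] 0) (𝓝 ((max (y 0) 0) ^ α)) :=
    ((h.continuousOn_max_rpow (by linarith [h.one_lt])) 0 self_mem_Ici).mono Ioi_subset_Ici_self
  have h2 : Tendsto (fun r => (2 / (α - 1) - 1) * (r * z r) - C * (r ^ 2 * (max (y r) 0) ^ α))
      (𝓝[>] 0) (𝓝 ((2 / (α - 1) - 1) * (0 * 0) - C * (0 ^ 2 * (max (y 0) 0) ^ α))) :=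
    ((tendsto_id_nhdsGT_zero.mul h.tendsto_deriv_zero).const_mul _).sub
      (((tendsto_id_nhdsGT_zero.pow 2).mul h1).const_mul C)
  have h3 : (2 / (α - 1) - 1) * (0 * 0) - C * (0 ^ 2 * (max (y 0) 0) ^ α) = 0 := by ring
  rw [h3] at h2
  refine h2.congr' ?_
  filter_upwards [self_mem_nhdsWithin] with r hr
  have hr' : r ≠ 0 := (mem_Ioi.1 hr).ne'
  unfold emdenFlux
  field_simp

/-- Pohozaev's inequality. The Pohozaev functional
`r³ (z² / 2 + C y ^ (α + 1) / (α + 1)) + r² y z / 2` vanishes at the origin and increases for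
subcritical `α`. -/
theorem pohozaev_pos (h : IsEmdenProfile C α R y z) {r : ℝ} (hr : 0 < r) (hrR : r < R) :
    0 < r ^ 2 * (z r ^ 2 / 2) + C / (α + 1) * (r ^ 2 * (y r ^ α * y r)) + r * (y r * z r) / 2 := by
  have hα := h.one_lt
  have hα5 := h.lt_five
  have hC := h.coeff_pos
  set E : ℝ → ℝ := fun r => r ^ 3 * (z r ^ 2 / 2) + C / (α + 1) * (r ^ 3 * (y r ^ (α + 1)))
    + r ^ 2 * (y r * z r) / 2 with hE
  have hd : ∀ x ∈ Ioo 0 R,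
      HasDerivAt E ((5 - α) / (2 * (α + 1)) * C * x ^ 2 * y x ^ (α + 1)) x := by
    intro x hx
    have hy := h.pos_of_lt x hx.1.le hx.2
    have dy := h.hasDerivAt x hx.1
    have dz := h.hasDerivAt_deriv x hx.1
    have dp := dy.rpow_const (p := α + 1) (Or.inl hy.ne')
    have d3 := (hasDerivAt_id x).pow 3
    have d2 := (hasDerivAt_id x).pow 2
    refine (((d3.mul ((dz.pow 2).div_const 2)).add ((d3.mul dp).const_mul (C / (α + 1)))).add
      ((d2.mul (dy.mul dz)).div_const 2)).congr_deriv ?_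
    have hx0 := hx.1.ne'
    have hα1 : α + 1 ≠ 0 := by linarith
    rw [max_eq_left hy.le, show α + 1 - 1 = α by ring, Real.rpow_add_one hy.ne']
    simp
    field_simp
    ring
  have h0 : Tendsto E (𝓝[>] 0) (𝓝 0) := by
    have hp : Tendsto (fun r => y r ^ (α + 1)) (𝓝[>] 0) (𝓝 (y 0 ^ (α + 1))) :=
      h.tendsto_nhdsGT_zero.rpow_const (Or.inr (by linarith))
    have h1 := (((tendsto_id_nhdsGT_zero.pow 3).mul ((h.tendsto_deriv_zero.pow 2).div_const 2)).add
      (((tendsto_id_nhdsGT_zero.pow 3).mul hp).const_mul (C / (α + 1)))).add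
      (((tendsto_id_nhdsGT_zero.pow 2).mul
        (h.tendsto_nhdsGT_zero.mul h.tendsto_deriv_zero)).div_const 2)
    simpa using h1
  have hmono : StrictMonoOn E (Ioo 0 R) := by
    refine strictMonoOn_of_deriv_pos (convex_Ioo 0 R)
      (fun x hx => (hd x hx).continuousAt.continuousWithinAt) ?_
    intro x hx
    rw [interior_Ioo] at hx
    rw [(hd x hx).deriv]
    have h1 := Real.rpow_pos_of_pos (h.pos_of_lt x hx.1.le hx.2) (α + 1)
    have h2 : 0 < 5 - α := by linarith
    have h3 := hx.1
    positivity
  have hmid : 0 ≤ E (r / 2) := by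
    refine le_of_tendsto h0 ?_
    filter_upwards [Ioo_mem_nhdsGT (half_pos hr)] with s hs
    exact (hmono ⟨hs.1, by linarith [hs.2]⟩ ⟨by linarith, by linarith⟩ hs.2).le
  have hlt : E (r / 2) < E r := hmono ⟨by linarith, by linarith⟩ ⟨hr, hrR⟩ (by linarith)
  have hpos : 0 < E r := by linarith
  have hy := h.pos_of_lt r hr.le hrR
  have hfac : E r = r * (r ^ 2 * (z r ^ 2 / 2) + C / (α + 1) * (r ^ 2 * (y r ^ α * y r))
      + r * (y r * z r) / 2) := by
    simp only [hE]
    rw [Real.rpow_add_one hy.ne']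
    ring
  rw [hfac] at hpos
  exact pos_of_mul_pos_right hpos hr.le

/-- In terms of `v = -r z / y` and `A = C r² y ^ (α - 1)`, this is `v² - v + A > 0`. -/
theorem logDeriv_growth_pos (h : IsEmdenProfile C α R y z) {r : ℝ} (hr : 0 < r) (hrR : r < R) :
    0 < r ^ 2 * z r ^ 2 + C * (r ^ 2 * (y r ^ α * y r)) + r * (y r * z r) := by
  have h1 := h.pohozaev_pos hr hrR
  have hα := h.one_lt
  have hC := h.coeff_pos
  have hy := h.pos_of_lt r hr.le hrR
  have h2 : C / (α + 1) * (r ^ 2 * (y r ^ α * y r)) ≤ C / 2 * (r ^ 2 * (y r ^ α * y r)) := by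
    have h3 : 0 < y r ^ α := Real.rpow_pos_of_pos hy α
    gcongr
    linarith
  linarith

/-- The logarithmic derivative `v = -r z / y` satisfies `r v' = v² - v + A`, with
`A = C r² y ^ (α - 1)`. -/
theorem strictMonoOn_logDeriv (h : IsEmdenProfile C α R y z) :
    StrictMonoOn (fun r => -(r * z r) / y r) (Ioo 0 R) := by
  have hd : ∀ r ∈ Ioo 0 R, HasDerivAt (fun r => -(r * z r) / y r)
      ((r ^ 2 * z r ^ 2 + C * (r ^ 2 * (y r ^ α * y r)) + r * (y r * z r)) / (r * y r ^ 2)) r := by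
    intro r hr
    have hy := h.pos_of_lt r hr.1.le hr.2
    have hr0 := hr.1.ne'
    refine ((((hasDerivAt_id r).mul (h.hasDerivAt_deriv r hr.1)).neg).div
      (h.hasDerivAt r hr.1) hy.ne').congr_deriv ?_
    rw [max_eq_left hy.le]
    simp
    field_simp
    ring
  refine strictMonoOn_of_deriv_pos (convex_Ioo 0 R)
    (fun x hx => (hd x hx).continuousAt.continuousWithinAt) ?_
  intro r hr
  rw [interior_Ioo] at hr
  rw [(hd r hr).deriv]
  have hy := h.pos_of_lt r hr.1.le hr.2
  have hr0 := hr.1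
  exact div_pos (h.logDeriv_growth_pos hr.1 hr.2) (by positivity)

theorem emdenScaling_neg_of_le (h : IsEmdenProfile C α R y z) {r : ℝ} (hr : R ≤ r) :
    emdenScaling α y z r < 0 := by
  have hα : 0 < α - 1 := by linarith [h.one_lt]
  have hr0 := h.radius_pos.trans_le hr
  have h1 := h.nonpos_of_le r hr
  have h2 := h.deriv_neg r hr0
  have h3 : r * z r < 0 := mul_neg_of_pos_of_neg hr0 h2
  have h4 : 2 / (α - 1) * y r ≤ 0 := mul_nonpos_of_nonneg_of_nonpos (by positivity) h1
  unfold emdenScaling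
  linarith

/-- The scaling generator changes sign exactly once, with a nonzero slope. -/
theorem exists_emdenScaling_zero (h : IsEmdenProfile C α R y z) :
    ∃ r₀ ∈ Ioo 0 R, emdenScaling α y z r₀ = 0 ∧ emdenFlux C α y z r₀ < 0 ∧
      (∀ r ∈ Ioo 0 r₀, 0 < emdenScaling α y z r) ∧
      ∀ r ∈ Ioi r₀, emdenScaling α y z r < 0 := by
  have hα : 0 < α - 1 := by linarith [h.one_lt]
  have hR := h.radius_pos
  have hy0 := h.pos_of_lt 0 le_rfl hR
  have hev : ∀ᶠ r in 𝓝[>] 0, 0 < emdenScaling α y z r :=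
    h.tendsto_emdenScaling.eventually_const_lt (by positivity)
  obtain ⟨a, ha, ha'⟩ := (hev.and (Ioo_mem_nhdsGT hR)).exists
  have hRneg := h.emdenScaling_neg_of_le le_rfl
  obtain ⟨r₀, hr₀, hw₀⟩ : (0 : ℝ) ∈ emdenScaling α y z '' Ioo a R :=
    intermediate_value_Ioo' ha'.2.le (h.continuousOn_emdenScaling.mono
      fun s hs => ha'.1.trans_le hs.1) ⟨hRneg, ha⟩
  have hr₀' : r₀ ∈ Ioo 0 R := ⟨ha'.1.trans hr₀.1, hr₀.2⟩
  have hfac : ∀ r ∈ Ioo 0 R,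
      emdenScaling α y z r = y r * (2 / (α - 1) - -(r * z r) / y r) := by
    intro r hr
    have hy := (h.pos_of_lt r hr.1.le hr.2).ne'
    unfold emdenScaling
    field_simp
    ring
  have hv₀ : -(r₀ * z r₀) / y r₀ = 2 / (α - 1) := by
    have hy := h.pos_of_lt r₀ hr₀'.1.le hr₀'.2
    rw [hfac r₀ hr₀', mul_eq_zero] at hw₀
    rcases hw₀ with h1 | h1 <;> linarith
  refine ⟨r₀, hr₀', hw₀, ?_, ?_, ?_⟩
  · have h1 := h.logDeriv_growth_pos hr₀'.1 hr₀'.2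
    have hy := h.pos_of_lt r₀ hr₀'.1.le hr₀'.2
    have h3 : y r₀ * emdenFlux C α y z r₀ = -(r₀ * (r₀ ^ 2 * z r₀ ^ 2 +
        C * (r₀ ^ 2 * (y r₀ ^ α * y r₀)) + r₀ * (y r₀ * z r₀))) := by
      unfold emdenFlux
      rw [← hv₀, max_eq_left hy.le]
      field_simp
      ring
    have h4 : y r₀ * emdenFlux C α y z r₀ < 0 := by
      rw [h3]
      exact neg_neg_of_pos (mul_pos hr₀'.1 h1)
    exact neg_of_mul_neg_right h4 hy.le
  · intro r hr
    have hr' : r ∈ Ioo 0 R := ⟨hr.1, hr.2.trans hr₀'.2⟩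
    have h1 := h.strictMonoOn_logDeriv hr' hr₀' hr.2
    simp only at h1
    rw [hfac r hr']
    exact mul_pos (h.pos_of_lt r hr'.1.le hr'.2) (by linarith)
  · intro r hr
    rcases le_or_gt R r with h2 | h2
    · exact h.emdenScaling_neg_of_le h2
    · have hr' : r ∈ Ioo 0 R := ⟨hr₀'.1.trans hr, h2⟩
      have h1 := h.strictMonoOn_logDeriv hr₀' hr' hr
      simp only at h1
      rw [hfac r hr']
      exact mul_neg_of_pos_of_neg (h.pos_of_lt r hr'.1.le hr'.2) (by linarith)

/-- Outside the star the flux is constant. -/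
theorem emdenFlux_eq_of_le (h : IsEmdenProfile C α R y z) {r : ℝ} (hr : R ≤ r) :
    emdenFlux C α y z r = emdenFlux C α y z R := by
  have hR := h.radius_pos
  rcases eq_or_lt_of_le hr with rfl | hr
  · rfl
  have hd : ∀ x, R ≤ x → HasDerivAt (emdenFlux C α y z) 0 x := by
    intro x hx
    simpa [h.emdenPotential_eq_zero hx] using h.hasDerivAt_emdenFlux (hR.trans_le hx)
  exact constant_of_has_deriv_right_zero
    (fun x hx => (hd x hx.1).continuousAt.continuousWithinAt)
    (fun x hx => (hd x hx.1).hasDerivWithinAt) r ⟨hr.le, le_rfl⟩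

/-- The scaling generator stays away from zero at infinity. -/
theorem exists_emdenScaling_le (h : IsEmdenProfile C α R y z) :
    ∃ c > 0, ∀ r, R + 1 ≤ r → emdenScaling α y z r ≤ -c := by
  have hα : 0 < α - 1 := by linarith [h.one_lt]
  have hR := h.radius_pos
  have h1 : y (R + 1) < 0 := by
    rw [← h.apply_radius]
    exact h.strictAntiOn (mem_Ici.2 hR.le) (mem_Ici.2 (by linarith)) (by linarith)
  refine ⟨2 / (α - 1) * -y (R + 1), mul_pos (by positivity) (by linarith), fun r hr => ?_⟩
  have h2 : y r ≤ y (R + 1) := h.strictAntiOn.antitoneOn (mem_Ici.2 (by linarith))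
    (mem_Ici.2 (by linarith)) hr
  have h3 : r * z r < 0 := mul_neg_of_pos_of_neg (by linarith) (h.deriv_neg r (by linarith))
  have h4 : 2 / (α - 1) * y r ≤ 2 / (α - 1) * y (R + 1) := by gcongr
  unfold emdenScaling
  linarith

end IsEmdenProfile

/-! ### Radial functions with finite Dirichlet integral -/

theorem absolutelyContinuousOnInterval_of_hasDerivAt {f f' : ℝ → ℝ} {a b : ℝ}
    (hf : ∀ x ∈ uIcc a b, HasDerivAt f (f' x) x) (hf' : ContinuousOn f' (uIcc a b)) :
    AbsolutelyContinuousOnInterval f a b := by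
  obtain ⟨B, hB⟩ := isCompact_uIcc.exists_bound_of_continuousOn hf'
  refine LipschitzOnWith.absolutelyContinuousOnInterval (K := B.toNNReal) ?_
  refine (convex_uIcc a b).lipschitzOnWith_of_nnnorm_hasDerivWithin_le
    (fun x hx => (hf x hx).hasDerivWithinAt) fun x hx => ?_
  rw [← NNReal.coe_le_coe, coe_nnnorm]
  exact (hB x hx).trans (Real.le_coe_toNNReal B)

theorem isLocallyAC_of_hasDerivAt {f f' : ℝ → ℝ} (hf : ∀ x, 0 < x → HasDerivAt f (f' x) x)
    (hf' : ContinuousOn f' (Ioi 0)) : IsLocallyAC f := by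
  intro a b ha hab
  have hsub : uIcc a b ⊆ Ioi 0 := by
    rw [uIcc_of_le hab]
    exact fun x hx => ha.trans_le hx.1
  exact absolutelyContinuousOnInterval_of_hasDerivAt (fun x hx => hf x (hsub hx)) (hf'.mono hsub)

theorem IsLocallyAC.continuousOn {f : ℝ → ℝ} (hf : IsLocallyAC f) : ContinuousOn f (Ioi 0) := by
  intro r hr
  have hr' : 0 < r := hr
  have h1 := (hf (r / 2) (r + 1) (by linarith) (by linarith)).continuousOn
  rw [uIcc_of_le (by linarith)] at h1
  exact (h1.continuousAt (Icc_mem_nhds (by linarith) (by linarith))).continuousWithinAt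

theorem IsLocallyAC.mul {f g : ℝ → ℝ} (hf : IsLocallyAC f) (hg : IsLocallyAC g) :
    IsLocallyAC (fun r => f r * g r) := fun a b ha hab =>
  (hf a b ha hab).fun_mul (hg a b ha hab)

theorem IsRadialL2.integrableOn_mul {f g : ℝ → ℝ} (hf : IsRadialL2 f) (hg : IsRadialL2 g) :
    IntegrableOn (fun r => r ^ 2 * (f r * g r)) (Ioi 0) := by
  have h1 := MemLp.integrable_mul hf hg
  refine h1.congr (ae_of_all _ fun r => ?_)
  simp only [Pi.mul_apply]
  ring

theorem IsRadialL2.integrableOn_sq {f : ℝ → ℝ} (hf : IsRadialL2 f) :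
    IntegrableOn (fun r => r ^ 2 * f r ^ 2) (Ioi 0) := by
  simpa only [sq] using hf.integrableOn_mul hf

theorem intervalIntegrable_of_integrableOn_Ioi {f : ℝ → ℝ} (hf : IntegrableOn f (Ioi 0)) {a b : ℝ}
    (ha : 0 ≤ a) (hb : 0 ≤ b) : IntervalIntegrable f volume a b := by
  rw [intervalIntegrable_iff]
  exact hf.mono_set fun x hx => (le_min ha hb).trans_lt hx.1

/-- The primitive of an integrable function on `(0, ∞)` is continuous up to the origin. -/
theorem tendsto_intervalIntegral {f : ℝ → ℝ} (hf : IntegrableOn f (Ioi 0)) {a c : ℝ}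
    (ha : 0 ≤ a) (hc : 0 ≤ c) :
    Tendsto (fun x => ∫ r in a..x, f r) (𝓝[Ioi 0] c) (𝓝 (∫ r in a..c, f r)) := by
  have h1 : Integrable ((Ioi (0 : ℝ)).indicator f) := hf.integrable_indicator measurableSet_Ioi
  have h2 : ∀ x, 0 ≤ x → ∫ r in a..x, (Ioi (0 : ℝ)).indicator f r = ∫ r in a..x, f r := by
    intro x hx
    refine intervalIntegral.integral_congr_ae (ae_of_all _ fun s hs => ?_)
    exact indicator_of_mem (mem_Ioi.2 ((le_min ha hx).trans_lt hs.1)) f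
  have h3 := (intervalIntegral.continuous_primitive
    (fun b c => h1.intervalIntegrable) a).tendsto c
  rw [h2 c hc] at h3
  refine (h3.mono_left nhdsWithin_le_nhds).congr' ?_
  filter_upwards [self_mem_nhdsWithin] with x hx
  exact h2 x (le_of_lt hx)

/-- The Cauchy-Schwarz bound for the increments of a function with finite Dirichlet integral. -/
theorem sq_sub_le_of_isLocallyAC {φ : ℝ → ℝ} (hac : IsLocallyAC φ) (hd : IsRadialL2 (deriv φ))
    {a b : ℝ} (ha : 0 < a) (hab : a ≤ b) :
    (φ b - φ a) ^ 2 ≤ (1 / a - 1 / b) * ∫ r in a..b, r ^ 2 * deriv φ r ^ 2 := by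
  rcases eq_or_lt_of_le hab with rfl | hab'
  · simp
  have hb : 0 < b := ha.trans hab'
  have hL : 0 < 1 / a - 1 / b := by
    rw [sub_pos]
    exact one_div_lt_one_div_of_lt ha hab'
  have hi1 : IntervalIntegrable (fun r => r ^ 2 * deriv φ r ^ 2) volume a b :=
    intervalIntegrable_of_integrableOn_Ioi hd.integrableOn_sq ha.le hb.le
  have hi2 : IntervalIntegrable (deriv φ) volume a b := (hac a b ha hab).intervalIntegrable_deriv
  have hpos : ∀ x ∈ uIcc a b, x ≠ 0 := fun x hx => by
    rw [uIcc_of_le hab] at hx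
    exact (ha.trans_le hx.1).ne'
  have hi3 : IntervalIntegrable (fun r : ℝ => 1 / r ^ 2) volume a b := by
    refine ContinuousOn.intervalIntegrable ?_
    exact continuousOn_const.div (continuousOn_id.pow 2) fun x hx => pow_ne_zero 2 (hpos x hx)
  have h3 : ∫ r in a..b, 1 / r ^ 2 = 1 / a - 1 / b := by
    have := intervalIntegral.integral_eq_sub_of_hasDerivAt (f := fun r : ℝ => -(1 / r))
      (f' := fun r : ℝ => 1 / r ^ 2) (a := a) (b := b) (fun x hx => ?_) hi3
    · rw [this]; ring
    · simpa [one_div] using (hasDerivAt_inv (hpos x hx)).fun_neg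
  have h2 : ∫ r in a..b, deriv φ r = φ b - φ a := (hac a b ha hab).integral_deriv_eq_sub
  -- the optimal multiple of `1 / r` to subtract from `r φ'`
  set m : ℝ := (φ b - φ a) / (1 / a - 1 / b) with hm
  have h4 : 0 ≤ ∫ r in a..b, (r ^ 2 * deriv φ r ^ 2 - 2 * m * deriv φ r + m ^ 2 * (1 / r ^ 2)) := by
    refine intervalIntegral.integral_nonneg hab fun r hr => ?_
    have hr0 : r ≠ 0 := (ha.trans_le hr.1).ne'
    have : r ^ 2 * deriv φ r ^ 2 - 2 * m * deriv φ r + m ^ 2 * (1 / r ^ 2) =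
        (r * deriv φ r - m / r) ^ 2 := by
      field_simp
      ring
    rw [this]
    exact sq_nonneg _
  rw [intervalIntegral.integral_add (hi1.sub (hi2.const_mul _)) (hi3.const_mul _),
    intervalIntegral.integral_sub hi1 (hi2.const_mul _), intervalIntegral.integral_const_mul,
    intervalIntegral.integral_const_mul, h2, h3] at h4
  have h5 : m * (1 / a - 1 / b) = φ b - φ a := div_mul_cancel₀ _ hL.ne'
  rw [← h5] at h4 ⊢
  have h6 : 0 ≤ (∫ r in a..b, r ^ 2 * deriv φ r ^ 2) - m ^ 2 * (1 / a - 1 / b) := by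
    nlinarith
  nlinarith

theorem intervalIntegral_le_integral_Ioi {f : ℝ → ℝ} (hf : IntegrableOn f (Ioi 0))
    (h0 : ∀ r, 0 ≤ f r) {a b : ℝ} (ha : 0 ≤ a) (hab : a ≤ b) :
    ∫ r in a..b, f r ≤ ∫ r in Ioi (0 : ℝ), f r := by
  rw [intervalIntegral.integral_of_le hab]
  exact setIntegral_mono_set hf (ae_of_all _ h0)
    (LE.le.eventuallyLE fun x hx => ha.trans_lt hx.1)

/-- The radial decay estimate `r φ² ≤ ∫ r² φ'²`. -/
theorem mul_sq_le_of_tendsto_zero {φ : ℝ → ℝ} (hac : IsLocallyAC φ) (hd : IsRadialL2 (deriv φ))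
    (hlim : Tendsto φ atTop (𝓝 0)) {a : ℝ} (ha : 0 < a) :
    a * φ a ^ 2 ≤ ∫ r in Ioi (0 : ℝ), r ^ 2 * deriv φ r ^ 2 := by
  set D := ∫ r in Ioi (0 : ℝ), r ^ 2 * deriv φ r ^ 2 with hD
  have hD0 : 0 ≤ D := integral_nonneg fun r => by positivity
  have h1 : Tendsto (fun b => (φ b - φ a) ^ 2) atTop (𝓝 ((0 - φ a) ^ 2)) :=
    (hlim.sub_const _).pow 2
  have h2 : (0 - φ a) ^ 2 ≤ 1 / a * D := by
    refine le_of_tendsto h1 ?_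
    filter_upwards [eventually_ge_atTop a] with b hb
    refine (sq_sub_le_of_isLocallyAC hac hd ha hb).trans ?_
    have h3 : ∫ r in a..b, r ^ 2 * deriv φ r ^ 2 ≤ D :=
      intervalIntegral_le_integral_Ioi hd.integrableOn_sq (fun r => by positivity) ha.le hb
    have h4 : 0 ≤ ∫ r in a..b, r ^ 2 * deriv φ r ^ 2 :=
      intervalIntegral.integral_nonneg hb fun r _ => by positivity
    have h5 : 0 < 1 / b := one_div_pos.2 (ha.trans_le hb)
    have h6 : 0 < 1 / a := one_div_pos.2 ha
    nlinarith
  have h3 : a * (0 - φ a) ^ 2 ≤ a * (1 / a * D) := mul_le_mul_of_nonneg_left h2 ha.le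
  have h4 : a * (1 / a * D) = D := by field_simp
  rw [h4] at h3
  linarith [show a * (0 - φ a) ^ 2 = a * φ a ^ 2 by ring]

/-- A function of finite Dirichlet integral vanishing at `r₀` satisfies
`φ(r)² = o(|r - r₀|)`. -/
theorem tendsto_sq_div_sub {φ : ℝ → ℝ} (hac : IsLocallyAC φ) (hd : IsRadialL2 (deriv φ))
    {r₀ : ℝ} (hr₀ : 0 < r₀) (h0 : φ r₀ = 0) :
    Tendsto (fun r => φ r ^ 2 / (r - r₀)) (𝓝[≠] r₀) (𝓝 0) := by
  have hi := hd.integrableOn_sq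
  have h1 : Tendsto (fun r => ∫ s in r₀..r, s ^ 2 * deriv φ s ^ 2) (𝓝[≠] r₀) (𝓝 0) := by
    have := tendsto_intervalIntegral hi hr₀.le hr₀.le
    rw [intervalIntegral.integral_same, (isOpen_Ioi.mem_nhds hr₀ : Ioi 0 ∈ 𝓝 r₀) |>
      nhdsWithin_eq_nhds.2] at this
    exact this.mono_left nhdsWithin_le_nhds
  have h2 : Tendsto (fun r : ℝ => 1 / (r * r₀)) (𝓝[≠] r₀) (𝓝 (1 / (r₀ * r₀))) := by
    refine Tendsto.mono_left ?_ nhdsWithin_le_nhds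
    refine tendsto_const_nhds.div (tendsto_id.mul_const _) (by positivity)
  have h3 : Tendsto (fun r => 1 / (r * r₀) * |∫ s in r₀..r, s ^ 2 * deriv φ s ^ 2|)
      (𝓝[≠] r₀) (𝓝 0) := by
    simpa using h2.mul h1.abs
  refine squeeze_zero_norm' ?_ h3
  filter_upwards [self_mem_nhdsWithin, nhdsWithin_le_nhds (Ioi_mem_nhds hr₀)] with r hne hr
  have hr' : 0 < r := hr
  rw [Real.norm_eq_abs, abs_div, abs_of_nonneg (sq_nonneg (φ r)),
    div_le_iff₀ (abs_pos.2 (sub_ne_zero.2 hne))]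
  rcases lt_or_gt_of_ne hne with hlt | hlt
  · have h4 := sq_sub_le_of_isLocallyAC hac hd hr' hlt.le
    rw [intervalIntegral.integral_symm, abs_neg, abs_of_nonneg
      (intervalIntegral.integral_nonneg hlt.le fun s _ => by positivity), abs_of_neg (by linarith)]
    rw [h0] at h4
    calc φ r ^ 2 = (0 - φ r) ^ 2 := by ring
      _ ≤ _ := h4
      _ = _ := by field_simp; ring
  · have h4 := sq_sub_le_of_isLocallyAC hac hd hr₀ hlt.le
    rw [abs_of_nonneg
      (intervalIntegral.integral_nonneg hlt.le fun s _ => by positivity), abs_of_pos (by linarith)]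
    rw [h0] at h4
    calc φ r ^ 2 = (φ r - 0) ^ 2 := by ring
      _ ≤ _ := h4
      _ = _ := by field_simp

/-! ### Jacobi's form of the quadratic form -/

/-- Picone's inequality: `r² φ'² - q r² φ² = (r φ' - p φ / (r w))² + (p φ² / w)'` whenever `w` has
no zeros, `p = r² w'` and `p' = -q r² w`. -/
theorem picone_le {w p q φ : ℝ → ℝ} {a b : ℝ} (ha : 0 < a) (hab : a ≤ b)
    (hw : ∀ r ∈ Icc a b, HasDerivAt w (p r / r ^ 2) r)
    (hp : ∀ r ∈ Icc a b, HasDerivAt p (-(q r * r ^ 2 * w r)) r)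
    (hq : ContinuousOn q (Icc a b)) (hne : ∀ r ∈ Icc a b, w r ≠ 0)
    (hac : IsLocallyAC φ) (hd : IsRadialL2 (deriv φ))
    (hi : IntervalIntegrable (fun r => r ^ 2 * (q r * φ r ^ 2)) volume a b) :
    p b / w b * φ b ^ 2 - p a / w a * φ a ^ 2 ≤
      ∫ r in a..b, (r ^ 2 * deriv φ r ^ 2 - r ^ 2 * (q r * φ r ^ 2)) := by
  have hcw : ContinuousOn w (Icc a b) := fun r hr => (hw r hr).continuousAt.continuousWithinAt
  have hcp : ContinuousOn p (Icc a b) := fun r hr => (hp r hr).continuousAt.continuousWithinAt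
  have hpos : ∀ r ∈ Icc a b, r ≠ 0 := fun r hr => (ha.trans_le hr.1).ne'
  have hdiv : ∀ r ∈ Icc a b, HasDerivAt (fun r => p r / w r)
      ((-(q r * r ^ 2 * w r) * w r - p r * (p r / r ^ 2)) / w r ^ 2) r :=
    fun r hr => (hp r hr).div (hw r hr) (hne r hr)
  have hcd : ContinuousOn (fun r => (-(q r * r ^ 2 * w r) * w r - p r * (p r / r ^ 2)) / w r ^ 2)
      (Icc a b) :=
    ((((hq.mul (continuousOn_id.pow 2)).mul hcw).neg.mul hcw).sub
      (hcp.mul (hcp.div (continuousOn_id.pow 2) fun r hr => pow_ne_zero 2 (hpos r hr)))).div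
      (hcw.pow 2) fun r hr => pow_ne_zero 2 (hne r hr)
  have hac1 : AbsolutelyContinuousOnInterval (fun r => p r / w r) a b := by
    rw [← uIcc_of_le hab] at hdiv hcd
    exact absolutelyContinuousOnInterval_of_hasDerivAt hdiv hcd
  have hac2 : AbsolutelyContinuousOnInterval (fun r => p r / w r * (φ r * φ r)) a b :=
    hac1.fun_mul ((hac a b ha hab).fun_mul (hac a b ha hab))
  have hF := hac2.integral_deriv_eq_sub
  simp only [← sq] at hF
  rw [← hF]
  refine intervalIntegral.integral_mono_ae_restrict hab ?_ ?_ ?_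
  · have := hac2.intervalIntegrable_deriv
    simpa only [← sq] using this
  · exact (intervalIntegrable_of_integrableOn_Ioi hd.integrableOn_sq ha.le
      (ha.le.trans hab)).sub hi
  · have hae : ∀ᵐ r ∂(volume.restrict (Icc a b)), DifferentiableAt ℝ φ r :=
      ae_restrict_of_ae_restrict_of_subset (fun x hx => ha.trans_le hx.1) hac.ae_differentiableAt
    filter_upwards [hae, ae_restrict_mem measurableSet_Icc] with r hr hrm
    have h1 := ((hdiv r hrm).mul (hr.hasDerivAt.pow 2)).deriv
    have h2 : deriv (fun r => p r / w r * φ r ^ 2) r = _ := h1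
    rw [h2]
    have hr0 := hpos r hrm
    have hw0 := hne r hrm
    have h3 : 0 ≤ (r * deriv φ r - p r * φ r / (r * w r)) ^ 2 := sq_nonneg _
    rw [← sub_nonneg]
    refine h3.trans_eq ?_
    simp
    field_simp
    ring

/-- If `w` is a solution of `(r² w')' = -q r² w` on `(0, ∞)` which is regular at the origin, stays
away from zero at infinity and has its only zero at `r₀`, then the form `∫ r² φ'² - ∫ r² q φ²` is
nonnegative on the functions that vanish at `r₀`. -/
theorem integral_potential_le_of_apply_eq_zero {w p q φ : ℝ → ℝ} {r₀ : ℝ} (hr₀ : 0 < r₀)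
    (hw : ∀ r, 0 < r → HasDerivAt w (p r / r ^ 2) r)
    (hp : ∀ r, 0 < r → HasDerivAt p (-(q r * r ^ 2 * w r)) r)
    (hq : ContinuousOn q (Ioi 0)) (hw₀ : w r₀ = 0) (hp₀ : p r₀ ≠ 0)
    (hne : ∀ r, 0 < r → r ≠ r₀ → w r ≠ 0)
    (hzero : Tendsto (fun r => p r / r / w r) (𝓝[>] 0) (𝓝 0))
    (hinf : ∃ B, ∀ᶠ r in atTop, |p r / w r| ≤ B)
    (hac : IsLocallyAC φ) (hd : IsRadialL2 (deriv φ)) (hlim : Tendsto φ atTop (𝓝 0))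
    (hi : IntegrableOn (fun r => r ^ 2 * (q r * φ r ^ 2)) (Ioi 0)) (h0 : φ r₀ = 0) :
    ∫ r in Ioi (0 : ℝ), r ^ 2 * (q r * φ r ^ 2) ≤ ∫ r in Ioi (0 : ℝ), r ^ 2 * deriv φ r ^ 2 := by
  set F : ℝ → ℝ := fun r => r ^ 2 * deriv φ r ^ 2 - r ^ 2 * (q r * φ r ^ 2) with hFdef
  have hF : IntegrableOn F (Ioi 0) := hd.integrableOn_sq.sub hi
  set G : ℝ → ℝ := fun r => p r / w r * φ r ^ 2 with hGdef
  have hle : ∀ a b, 0 < a → a ≤ b → (∀ r ∈ Icc a b, r ≠ r₀) → G b - G a ≤ ∫ r in a..b, F r := by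
    intro a b ha hab hr
    have hsub : Icc a b ⊆ Ioi 0 := fun r hr => ha.trans_le hr.1
    exact picone_le ha hab (fun r hr => hw r (hsub hr)) (fun r hr => hp r (hsub hr)) (hq.mono hsub)
      (fun r h => hne r (hsub h) (hr r h)) hac hd
      (intervalIntegrable_of_integrableOn_Ioi hi ha.le (ha.le.trans hab))
  have hG₀ : Tendsto G (𝓝[≠] r₀) (𝓝 0) := by
    have h1 := hasDerivAt_iff_tendsto_slope.1 (hw r₀ hr₀)
    have h2 : Tendsto (fun r => p r * (slope w r₀ r)⁻¹ * (φ r ^ 2 / (r - r₀))) (𝓝[≠] r₀)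
        (𝓝 (p r₀ * (p r₀ / r₀ ^ 2)⁻¹ * 0)) :=
      ((tendsto_nhdsWithin_of_tendsto_nhds (hp r₀ hr₀).continuousAt).mul
        (h1.inv₀ (div_ne_zero hp₀ (by positivity)))).mul (tendsto_sq_div_sub hac hd hr₀ h0)
    rw [mul_zero] at h2
    refine h2.congr' ?_
    filter_upwards [self_mem_nhdsWithin] with r hr
    have hr' : r - r₀ ≠ 0 := sub_ne_zero.2 hr
    rw [slope_def_field, hw₀, sub_zero, inv_div]
    simp only [hGdef]
    field_simp
  have hG0 : Tendsto G (𝓝[>] 0) (𝓝 0) := by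
    set D := ∫ r in Ioi (0 : ℝ), r ^ 2 * deriv φ r ^ 2 with hD
    have h1 : Tendsto (fun r => |p r / r / w r| * D) (𝓝[>] 0) (𝓝 0) := by
      simpa using hzero.abs.mul_const D
    refine squeeze_zero_norm' ?_ h1
    filter_upwards [self_mem_nhdsWithin] with r hr
    have hr' : r ≠ 0 := (mem_Ioi.1 hr).ne'
    have h2 : G r = p r / r / w r * (r * φ r ^ 2) := by
      simp only [hGdef]
      field_simp
    have h3 : 0 ≤ r * φ r ^ 2 := mul_nonneg (le_of_lt hr) (sq_nonneg _)
    rw [h2, Real.norm_eq_abs, abs_mul, abs_of_nonneg h3]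
    exact mul_le_mul_of_nonneg_left (mul_sq_le_of_tendsto_zero hac hd hlim hr) (abs_nonneg _)
  have hGinf : Tendsto G atTop (𝓝 0) := by
    obtain ⟨B, hB⟩ := hinf
    have h1 : Tendsto (fun r => B * φ r ^ 2) atTop (𝓝 0) := by
      simpa using (hlim.pow 2).const_mul B
    refine squeeze_zero_norm' ?_ h1
    filter_upwards [hB] with r hr
    simp only [hGdef]
    rw [Real.norm_eq_abs, abs_mul, abs_of_nonneg (sq_nonneg (φ r))]
    exact mul_le_mul_of_nonneg_right hr (sq_nonneg _)
  have hmem : Ioi (0 : ℝ) ∈ 𝓝 r₀ := Ioi_mem_nhds hr₀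
  have htend : ∀ a, 0 ≤ a → Tendsto (fun x => ∫ r in a..x, F r) (𝓝 r₀) (𝓝 (∫ r in a..r₀, F r)) := by
    intro a ha
    have := tendsto_intervalIntegral hF ha hr₀.le
    rwa [nhdsWithin_eq_nhds.2 hmem] at this
  -- the inner interval `(0, r₀)`
  have hin : 0 ≤ ∫ r in (0 : ℝ)..r₀, F r := by
    have h1 : ∀ a ∈ Ioo 0 r₀, -G a ≤ ∫ r in a..r₀, F r := by
      intro a ha
      have h2 : Tendsto (fun b => G b - G a) (𝓝[<] r₀) (𝓝 (0 - G a)) :=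
        (hG₀.mono_left (nhdsWithin_mono _ fun x hx => ne_of_lt hx)).sub_const _
      rw [zero_sub] at h2
      refine le_of_tendsto_of_tendsto h2 ((htend a ha.1.le).mono_left nhdsWithin_le_nhds) ?_
      filter_upwards [Ioo_mem_nhdsLT ha.2] with b hb
      exact hle a b ha.1 hb.1.le fun r hr => (hr.2.trans_lt hb.2).ne
    have h2 : Tendsto (fun a => ∫ r in a..r₀, F r) (𝓝[>] 0) (𝓝 (∫ r in (0 : ℝ)..r₀, F r)) := by
      have := (tendsto_intervalIntegral hF hr₀.le le_rfl).neg
      simpa only [← intervalIntegral.integral_symm] using this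
    have h3 := hG0.neg
    rw [neg_zero] at h3
    refine le_of_tendsto_of_tendsto h3 h2 ?_
    filter_upwards [Ioo_mem_nhdsGT hr₀] with a ha
    exact h1 a ha
  -- the outer interval `(r₀, ∞)`
  have hFr₀ : IntegrableOn F (Ioi r₀) := hF.mono_set (Ioi_subset_Ioi hr₀.le)
  have hout : 0 ≤ ∫ r in Ioi r₀, F r := by
    have h1 : ∀ b ∈ Ioi r₀, G b ≤ ∫ r in r₀..b, F r := by
      intro b hb
      have hb0 : 0 < b := hr₀.trans hb
      have h2 : Tendsto (fun a => G b - G a) (𝓝[>] r₀) (𝓝 (G b - 0)) :=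
        (hG₀.mono_left (nhdsWithin_mono _ fun x hx => (ne_of_gt hx))).const_sub _
      rw [sub_zero] at h2
      have h3 : Tendsto (fun a => ∫ r in a..b, F r) (𝓝 r₀) (𝓝 (∫ r in r₀..b, F r)) := by
        have := (htend b hb0.le).neg
        simpa only [← intervalIntegral.integral_symm] using this
      refine le_of_tendsto_of_tendsto h2 (h3.mono_left nhdsWithin_le_nhds) ?_
      filter_upwards [Ioo_mem_nhdsGT hb] with a ha
      exact hle a b (hr₀.trans ha.1) ha.2.le fun r hr => (ha.1.trans_le hr.1).ne'
    refine le_of_tendsto_of_tendsto hGinf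
      (intervalIntegral_tendsto_integral_Ioi r₀ hFr₀ tendsto_id) ?_
    filter_upwards [eventually_gt_atTop r₀] with b hb
    exact h1 b hb
  have hsplit : ∫ r in Ioi (0 : ℝ), F r = (∫ r in (0 : ℝ)..r₀, F r) + ∫ r in Ioi r₀, F r := by
    rw [intervalIntegral.integral_of_le hr₀.le, ← setIntegral_union Ioc_disjoint_Ioi_same
      measurableSet_Ioi (hF.mono_set Ioc_subset_Ioi_self) hFr₀, Ioc_union_Ioi_eq_Ioi hr₀.le]
  have hsub : ∫ r in Ioi (0 : ℝ), F r = (∫ r in Ioi (0 : ℝ), r ^ 2 * deriv φ r ^ 2) -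
      ∫ r in Ioi (0 : ℝ), r ^ 2 * (q r * φ r ^ 2) := integral_sub hd.integrableOn_sq hi
  linarith

/-! ### Shooting for the radial Schrödinger equation -/

/-- `u` solves `u'' = (E - q) u` on `[0, R]` with `u(0) = 0` and `u'(0) = s`, where `v = u'`. In
terms of `φ = u / r`, this is the equation `-Δ φ - q φ = -E φ` for a radial function which is
regular at the origin of `ℝ³`. -/
structure IsRegularSolution (q : ℝ → ℝ) (R s E : ℝ) (u v : ℝ → ℝ) : Prop where
  apply_zero : u 0 = 0
  deriv_zero : v 0 = s
  hasDerivWithinAt : ∀ t ∈ Icc 0 R, HasDerivWithinAt u (v t) (Icc 0 R) t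
  hasDerivWithinAt_deriv : ∀ t ∈ Icc 0 R, HasDerivWithinAt v ((E - q t) * u t) (Icc 0 R) t

/-- The truncation of `x` to the interval `[-B, B]`. -/
def clip (B x : ℝ) : ℝ := max (min x B) (-B)

theorem abs_clip_le {B : ℝ} (hB : 0 ≤ B) (x : ℝ) : |clip B x| ≤ B :=
  abs_le.2 ⟨le_max_right _ _, max_le (min_le_right _ _) (by linarith)⟩

theorem abs_clip_sub_clip_le (B x y : ℝ) : |clip B x - clip B y| ≤ |x - y| :=
  (abs_max_sub_max_le_abs _ _ _).trans (abs_inf_sub_inf_le_abs x y B)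

theorem clip_eq_self {B x : ℝ} (hx : |x| ≤ B) : clip B x = x := by
  unfold clip
  rw [min_eq_left (abs_le.1 hx).2, max_eq_left (abs_le.1 hx).1]

theorem abs_clip_le_abs {B : ℝ} (hB : 0 ≤ B) (x : ℝ) : |clip B x| ≤ |x| := by
  simpa [clip_eq_self (abs_zero.trans_le hB)] using abs_clip_sub_clip_le B x 0

/-- Linear equations have global solutions: the vector field is truncated to a bounded one, and
Grönwall's inequality shows that the solution never sees the truncation. -/
theorem exists_isRegularSolution {q : ℝ → ℝ} {R : ℝ} (hR : 0 ≤ R) (hq : ContinuousOn q (Icc 0 R))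
    (s E : ℝ) : ∃ u v, IsRegularSolution q R s E u v := by
  obtain ⟨A, hA⟩ := isCompact_Icc.exists_bound_of_continuousOn (continuousOn_const.sub hq :
    ContinuousOn (fun t => E - q t) (Icc 0 R))
  set K : ℝ := max 1 A with hKdef
  have hK1 : 1 ≤ K := le_max_left _ _
  have hK0 : 0 ≤ K := zero_le_one.trans hK1
  have hKA : ∀ t ∈ Icc 0 R, |E - q t| ≤ K := fun t ht => (hA t ht).trans (le_max_right _ _)
  set B : ℝ := |s| * Real.exp (K * R) with hBdef
  have hB : 0 ≤ B := by positivity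
  set f : ℝ → ℝ × ℝ → ℝ × ℝ := fun t x => (clip B x.2, (E - q t) * clip B x.1) with hf
  have hfK : ∀ t ∈ Icc 0 R, ∀ c : ℝ, ∀ a b : ℝ, |a| ≤ c → |b| ≤ c →
      ‖((a, (E - q t) * b) : ℝ × ℝ)‖ ≤ K * c := by
    intro t ht c a b ha hb
    have hc : 0 ≤ c := (abs_nonneg a).trans ha
    rw [Prod.norm_def]
    refine max_le ?_ ?_
    · exact ha.trans (le_mul_of_one_le_left hc hK1)
    · simp only [Real.norm_eq_abs, abs_mul]
      exact mul_le_mul (hKA t ht) hb (abs_nonneg _) hK0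
  have hPL : IsPicardLindelof f (⟨0, left_mem_Icc.2 hR⟩ : Icc 0 R) ((0, s) : ℝ × ℝ)
      (K * B * R).toNNReal 0 (K * B).toNNReal K.toNNReal := by
    refine ⟨fun t ht => ?_, fun x _ => ?_, fun t ht x _ => ?_, ?_⟩
    · refine LipschitzWith.lipschitzOnWith (LipschitzWith.of_dist_le_mul fun x y => ?_)
      rw [Real.coe_toNNReal K hK0, dist_eq_norm, dist_eq_norm]
      have h1 : f t x - f t y =
          (clip B x.2 - clip B y.2, (E - q t) * (clip B x.1 - clip B y.1)) := by
        simp only [hf, Prod.mk_sub_mk]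
        ring_nf
      rw [h1]
      refine hfK t ht _ _ _ ?_ ?_
      · exact (abs_clip_sub_clip_le B _ _).trans (norm_snd_le (x - y))
      · exact (abs_clip_sub_clip_le B _ _).trans (norm_fst_le (x - y))
    · exact continuousOn_const.prodMk ((continuousOn_const.sub hq).mul continuousOn_const)
    · rw [Real.coe_toNNReal _ (by positivity)]
      exact hfK t ht _ _ _ (abs_clip_le hB _) (abs_clip_le hB _)
    · rw [Real.coe_toNNReal _ (by positivity), Real.coe_toNNReal _ (by positivity)]
      simp [hR]
  obtain ⟨x, hx0, hx⟩ := hPL.exists_eq_forall_mem_Icc_hasDerivWithinAt₀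
  have hcont : ContinuousOn x (Icc 0 R) := fun t ht => (hx t ht).continuousWithinAt
  have hbound : ∀ t ∈ Icc 0 R, ‖x t‖ ≤ B := by
    intro t ht
    have h1 := norm_le_gronwallBound_of_norm_deriv_right_le (δ := |s|) (K := K) (ε := 0) hcont
      (fun t ht => ((hx t (Ico_subset_Icc_self ht)).mono_of_mem_nhdsWithin
        (Icc_mem_nhdsGE_of_mem ht))) (by rw [hx0]; simp [Prod.norm_def]) (fun t ht => by
        rw [add_zero]
        exact hfK t (Ico_subset_Icc_self ht) _ _ _
          ((abs_clip_le_abs hB _).trans (norm_snd_le (x t)))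
          ((abs_clip_le_abs hB _).trans (norm_fst_le (x t)))) t ht
    rw [gronwallBound_ε0, sub_zero] at h1
    refine h1.trans ?_
    have := ht.2
    rw [hBdef]
    gcongr
  refine ⟨fun t => (x t).1, fun t => (x t).2, by simp [hx0], by simp [hx0], fun t ht => ?_,
    fun t ht => ?_⟩
  · have h1 := (ContinuousLinearMap.fst ℝ ℝ ℝ).hasFDerivAt.comp_hasDerivWithinAt t (hx t ht)
    rwa [ContinuousLinearMap.coe_fst', show (f t (x t)).1 = (x t).2 from
      clip_eq_self ((norm_snd_le (x t)).trans (hbound t ht))] at h1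
  · have h1 := (ContinuousLinearMap.snd ℝ ℝ ℝ).hasFDerivAt.comp_hasDerivWithinAt t (hx t ht)
    rwa [ContinuousLinearMap.coe_snd', show (f t (x t)).2 = (E - q t) * (x t).1 by
      simp only [hf]
      rw [clip_eq_self ((norm_fst_le (x t)).trans (hbound t ht))]] at h1

namespace IsRegularSolution

variable {q : ℝ → ℝ} {R s E : ℝ} {u v : ℝ → ℝ}

theorem continuousOn (h : IsRegularSolution q R s E u v) : ContinuousOn u (Icc 0 R) :=
  fun t ht => (h.hasDerivWithinAt t ht).continuousWithinAt

theorem continuousOn_deriv (h : IsRegularSolution q R s E u v) : ContinuousOn v (Icc 0 R) :=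
  fun t ht => (h.hasDerivWithinAt_deriv t ht).continuousWithinAt

/-- Continuous dependence on the energy. -/
theorem norm_sub_le (h : IsRegularSolution q R s E u v) {E' : ℝ} {u' v' : ℝ → ℝ}
    (h' : IsRegularSolution q R s E' u' v') (hR : 0 ≤ R) {K B : ℝ} (hK1 : 1 ≤ K)
    (hK : ∀ t ∈ Icc 0 R, |E' - q t| ≤ K) (hB : ∀ t ∈ Icc 0 R, |u t| ≤ B) :
    ‖(u' R - u R, v' R - v R)‖ ≤ gronwallBound 0 K (|E' - E| * B) R := by
  have hd : ∀ t ∈ Ico 0 R, HasDerivWithinAt (fun t => (u' t - u t, v' t - v t))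
      (v' t - v t, (E' - q t) * u' t - (E - q t) * u t) (Ici t) t := by
    intro t ht
    have ht' := Ico_subset_Icc_self ht
    have := ((h'.hasDerivWithinAt t ht').sub (h.hasDerivWithinAt t ht')).prodMk
      ((h'.hasDerivWithinAt_deriv t ht').sub (h.hasDerivWithinAt_deriv t ht'))
    exact this.mono_of_mem_nhdsWithin (Icc_mem_nhdsGE_of_mem ht)
  have h1 := norm_le_gronwallBound_of_norm_deriv_right_le (δ := 0) (K := K) (ε := |E' - E| * B)
    (((h'.continuousOn.sub h.continuousOn)).prodMk (h'.continuousOn_deriv.sub h.continuousOn_deriv))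
    hd (by simp [h.apply_zero, h'.apply_zero, h.deriv_zero, h'.deriv_zero]) (fun t ht => ?_) R
    (right_mem_Icc.2 hR)
  · simpa using h1
  · have ht' := Ico_subset_Icc_self ht
    have hB0 : 0 ≤ B := (abs_nonneg _).trans (hB t ht')
    have h2 : |v' t - v t| ≤ ‖(u' t - u t, v' t - v t)‖ := norm_snd_le (u' t - u t, v' t - v t)
    have h3 : |u' t - u t| ≤ ‖(u' t - u t, v' t - v t)‖ := norm_fst_le (u' t - u t, v' t - v t)
    have h4 : 0 ≤ ‖(u' t - u t, v' t - v t)‖ := norm_nonneg _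
    have h5 : 0 ≤ |E' - E| * B := by positivity
    rw [Prod.norm_def]
    refine max_le ?_ ?_
    · have : |v' t - v t| ≤ K * ‖(u' t - u t, v' t - v t)‖ :=
        h2.trans (le_mul_of_one_le_left h4 hK1)
      simp only [Real.norm_eq_abs]
      exact this.trans (le_add_of_nonneg_right h5)
    · simp only [Real.norm_eq_abs]
      rw [show (E' - q t) * u' t - (E - q t) * u t =
        (E' - q t) * (u' t - u t) + (E' - E) * u t by ring]
      refine (abs_add_le _ _).trans ?_
      rw [abs_mul, abs_mul]
      exact add_le_add (mul_le_mul (hK t ht') h3 (abs_nonneg _) (zero_le_one.trans hK1))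
        (mul_le_mul_of_nonneg_left (hB t ht') (abs_nonneg _))

theorem apply_unique (h : IsRegularSolution q R s E u v) {u' v' : ℝ → ℝ}
    (h' : IsRegularSolution q R s E u' v') (hR : 0 ≤ R) (hq : ContinuousOn q (Icc 0 R)) :
    u' R = u R ∧ v' R = v R := by
  obtain ⟨A, hA⟩ := isCompact_Icc.exists_bound_of_continuousOn (continuousOn_const.sub hq :
    ContinuousOn (fun t => E - q t) (Icc 0 R))
  obtain ⟨B, hB⟩ := isCompact_Icc.exists_bound_of_continuousOn h.continuousOn
  have h1 := h.norm_sub_le h' hR (K := max 1 A) (B := B) (le_max_left _ _)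
    (fun t ht => (hA t ht).trans (le_max_right _ _)) hB
  rw [sub_self, abs_zero, zero_mul, gronwallBound_ε0_δ0, norm_le_zero_iff, Prod.mk_eq_zero] at h1
  exact ⟨sub_eq_zero.1 h1.1, sub_eq_zero.1 h1.2⟩

/-- If `E ≥ q`, then `u u'` and hence `u²` is nondecreasing, so that `u` keeps its sign. -/
theorem pos_of_le (h : IsRegularSolution q R s E u v) (hR : 0 < R) (hs : 0 < s)
    (hE : ∀ t ∈ Icc 0 R, q t ≤ E) : 0 < u R ∧ 0 ≤ v R := by
  have hin : ∀ t ∈ Ioo 0 R, Icc 0 R ∈ 𝓝 t := fun t ht => Icc_mem_nhds ht.1 ht.2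
  have hu : ∀ t ∈ Ioo 0 R, HasDerivAt u (v t) t := fun t ht =>
    (h.hasDerivWithinAt t (Ioo_subset_Icc_self ht)).hasDerivAt (hin t ht)
  have hv : ∀ t ∈ Ioo 0 R, HasDerivAt v ((E - q t) * u t) t := fun t ht =>
    (h.hasDerivWithinAt_deriv t (Ioo_subset_Icc_self ht)).hasDerivAt (hin t ht)
  have hmono : MonotoneOn (fun t => u t * v t) (Icc 0 R) := by
    refine monotoneOn_of_deriv_nonneg (convex_Icc 0 R) (h.continuousOn.mul h.continuousOn_deriv)
      ?_ ?_
    · rw [interior_Icc]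
      exact fun t ht => ((hu t ht).mul (hv t ht)).differentiableAt.differentiableWithinAt
    · rw [interior_Icc]
      intro t ht
      have h1 : deriv (fun t => u t * v t) t = _ := ((hu t ht).mul (hv t ht)).deriv
      rw [h1]
      have h2 : 0 ≤ E - q t := sub_nonneg.2 (hE t (Ioo_subset_Icc_self ht))
      nlinarith [mul_nonneg h2 (sq_nonneg (u t)), sq_nonneg (v t)]
  have huv : ∀ t ∈ Icc 0 R, 0 ≤ u t * v t := by
    intro t ht
    have := hmono (left_mem_Icc.2 hR.le) ht ht.1
    simpa [h.apply_zero] using this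
  have hsq : MonotoneOn (fun t => u t ^ 2) (Icc 0 R) := by
    refine monotoneOn_of_deriv_nonneg (convex_Icc 0 R) (h.continuousOn.pow 2) ?_ ?_
    · rw [interior_Icc]
      exact fun t ht => ((hu t ht).pow 2).differentiableAt.differentiableWithinAt
    · rw [interior_Icc]
      intro t ht
      have h1 : deriv (fun t => u t ^ 2) t = _ := ((hu t ht).pow 2).deriv
      rw [h1]
      have := huv t (Ioo_subset_Icc_self ht)
      simp
      linarith
  -- `u` is positive immediately to the right of the origin
  obtain ⟨t, ht, htu⟩ : ∃ t ∈ Ioo 0 R, 0 < u t := by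
    have h1 := (h.hasDerivWithinAt 0 (left_mem_Icc.2 hR.le)).mono_of_mem_nhdsWithin
      (Icc_mem_nhdsGE hR : Icc 0 R ∈ 𝓝[≥] 0)
    rw [h.deriv_zero] at h1
    have h2 := (hasDerivWithinAt_iff_tendsto_slope' self_notMem_Ioi).1
      (hasDerivWithinAt_Ioi_iff_Ici.2 h1)
    obtain ⟨t, ht1, ht2⟩ := ((h2.eventually_const_lt hs).and (Ioo_mem_nhdsGT hR)).exists
    refine ⟨t, ht2, ?_⟩
    rw [slope_def_field, h.apply_zero, sub_zero, sub_zero] at ht1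
    exact (div_pos_iff_of_pos_right ht2.1).1 ht1
  have huR : 0 < u R := by
    by_contra hneg
    obtain ⟨c, hc, hc0⟩ : (0 : ℝ) ∈ u '' Icc t R :=
      intermediate_value_Icc' ht.2.le (h.continuousOn.mono (Icc_subset_Icc_left ht.1.le))
        ⟨not_lt.1 hneg, htu.le⟩
    have h1 : u t ^ 2 ≤ u c ^ 2 :=
      hsq (Ioo_subset_Icc_self ht) ⟨ht.1.le.trans hc.1, hc.2⟩ hc.1
    rw [hc0] at h1
    nlinarith
  exact ⟨huR, nonneg_of_mul_nonneg_right (huv R (right_mem_Icc.2 hR.le)) huR⟩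

/-- If the zero-energy solution bends down at `R`, then the shooting function `u'(R) + κ u(R)`
changes sign, and some solution with energy `κ²` matches a decaying exponential at `R`. -/
theorem exists_matching (h : IsRegularSolution q R s 0 u v) (hR : 0 < R) (hs : 0 < s)
    (hq : ContinuousOn q (Icc 0 R)) (hneg : v R < 0) :
    ∃ κ > 0, ∃ u' v', IsRegularSolution q R s (κ ^ 2) u' v' ∧ v' R = -(κ * u' R) := by
  choose U V hUV using fun κ : ℝ => exists_isRegularSolution hR.le hq s (κ ^ 2)
  obtain ⟨A, hA⟩ := isCompact_Icc.exists_bound_of_continuousOn hq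
  have hqA : ∀ t ∈ Icc 0 R, |q t| ≤ A := hA
  have hA0 : 0 ≤ A := (abs_nonneg _).trans (hqA 0 (left_mem_Icc.2 hR.le))
  set κ₁ : ℝ := A + 1 with hκ₁
  have hκ₁0 : 0 < κ₁ := by linarith
  set f : ℝ → ℝ := fun κ => V κ R + κ * U κ R with hf
  have hUVc : ∀ κ₀ ∈ Icc 0 κ₁,
      Tendsto (fun κ => (U κ R - U κ₀ R, V κ R - V κ₀ R)) (𝓝[Icc 0 κ₁] κ₀) (𝓝 0) := by
    intro κ₀ _
    obtain ⟨B, hB⟩ := isCompact_Icc.exists_bound_of_continuousOn (hUV κ₀).continuousOn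
    have hlim : Tendsto (fun κ : ℝ => gronwallBound 0 (max 1 (κ₁ ^ 2 + A))
        (|κ ^ 2 - κ₀ ^ 2| * B) R) (𝓝[Icc 0 κ₁] κ₀) (𝓝 0) := by
      have hc : Continuous (fun κ : ℝ => gronwallBound 0 (max 1 (κ₁ ^ 2 + A))
          (|κ ^ 2 - κ₀ ^ 2| * B) R) :=
        (gronwallBound_continuous_ε 0 _ R).comp
          (((continuous_pow 2).sub continuous_const).abs.mul continuous_const)
      have := hc.tendsto κ₀
      rw [sub_self, abs_zero, zero_mul, gronwallBound_ε0_δ0] at this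
      exact this.mono_left nhdsWithin_le_nhds
    refine squeeze_zero_norm' ?_ hlim
    filter_upwards [self_mem_nhdsWithin] with κ hκ
    refine (hUV κ₀).norm_sub_le (hUV κ) hR.le (le_max_left _ _) (fun t ht => ?_) hB
    refine le_trans ?_ (le_max_right _ _)
    refine (abs_sub _ _).trans (add_le_add ?_ (hqA t ht))
    rw [abs_of_nonneg (sq_nonneg κ)]
    exact pow_le_pow_left₀ hκ.1 hκ.2 2
  have hcont : ContinuousOn f (Icc 0 κ₁) := by
    intro κ₀ hκ₀
    have hlim := hUVc κ₀ hκ₀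
    have h1 : Tendsto (fun κ => U κ R - U κ₀ R) (𝓝[Icc 0 κ₁] κ₀) (𝓝 0) :=
      (continuous_fst.tendsto (0 : ℝ × ℝ)).comp hlim
    have h2 : Tendsto (fun κ => V κ R - V κ₀ R) (𝓝[Icc 0 κ₁] κ₀) (𝓝 0) :=
      (continuous_snd.tendsto (0 : ℝ × ℝ)).comp hlim
    have h3 := tendsto_sub_nhds_zero_iff.1 h1
    have h4 := tendsto_sub_nhds_zero_iff.1 h2
    exact h4.add ((tendsto_nhdsWithin_of_tendsto_nhds tendsto_id).mul h3)
  have hf0 : f 0 < 0 := by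
    have h0 := hUV 0
    rw [zero_pow two_ne_zero] at h0
    simp only [hf, zero_mul, add_zero]
    rw [(h.apply_unique h0 hR.le hq).2]
    exact hneg
  have hf1 : 0 ≤ f κ₁ := by
    have h1 := (hUV κ₁).pos_of_le hR hs fun t ht =>
      (le_abs_self _).trans ((hqA t ht).trans (by nlinarith))
    have := mul_pos hκ₁0 h1.1
    simp only [hf]
    linarith [h1.2]
  obtain ⟨κ, hκ, hκ0⟩ := intermediate_value_Icc hκ₁0.le hcont ⟨hf0.le, hf1⟩
  have hne : κ ≠ 0 := by
    rintro rfl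
    exact hf0.ne hκ0
  refine ⟨κ, lt_of_le_of_ne hκ.1 hne.symm, U κ, V κ, hUV κ, ?_⟩
  simp only [hf] at hκ0
  linarith

end IsRegularSolution

/-! ### Integration by parts in `H²_r` -/

/-- If `g / r` is integrable, then `g` has no nonzero limit at an end of `(0, ∞)` where `log` is
unbounded. -/
theorem tendsto_eq_zero_of_integrableOn_div {g : ℝ → ℝ} {l : Filter ℝ} [l.NeBot]
    [TendstoIxxClass Icc l l] (hl : Ioi 0 ∈ l) (hlog : Tendsto (fun r => ‖Real.log r‖) l atTop)
    (hg : IntegrableOn (fun r => g r / r) (Ioi 0)) {L : ℝ} (hL : Tendsto g l (𝓝 L)) : L = 0 := by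
  by_contra hne
  have h1 : deriv Real.log =O[l] fun r => g r / r := by
    have h2 : ∀ᶠ r in l, |L| / 2 < |g r| :=
      hL.abs.eventually_const_lt (half_lt_self (abs_pos.2 hne))
    refine Asymptotics.IsBigO.of_bound (2 / |L|) ?_
    filter_upwards [h2, hl] with r hr hr0
    have hr0' : 0 < r := hr0
    have hL0 : 0 < |L| := abs_pos.2 hne
    rw [Real.deriv_log, Real.norm_eq_abs, Real.norm_eq_abs, abs_div, abs_inv, abs_of_pos hr0']
    rw [show 2 / |L| * (|g r| / r) = (2 * |g r| / |L|) * r⁻¹ by field_simp]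
    refine le_mul_of_one_le_left (by positivity) ?_
    rw [le_div_iff₀ hL0]
    linarith
  refine not_integrableOn_of_tendsto_norm_atTop_of_deriv_isBigO_filter l hl ?_ hlog h1 hg
  filter_upwards [hl] with r hr
  exact Real.differentiableAt_log (ne_of_gt hr)

/-- The integral of `g'` over `(0, ∞)` vanishes if `g / r` is integrable: `1 / r` is integrable
neither at the origin nor at infinity, so that the boundary terms vanish. -/
theorem integral_deriv_eq_zero {g : ℝ → ℝ} (hac : IsLocallyAC g)
    (hd : IntegrableOn (deriv g) (Ioi 0)) (hg : IntegrableOn (fun r => g r / r) (Ioi 0)) :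
    ∫ r in Ioi (0 : ℝ), deriv g r = 0 := by
  have hftc : ∀ a b, 0 < a → a ≤ b → ∫ r in a..b, deriv g r = g b - g a := fun a b ha hab =>
    (hac a b ha hab).integral_deriv_eq_sub
  have h1 : Tendsto g atTop (𝓝 (g 1 + ∫ r in Ioi (1 : ℝ), deriv g r)) := by
    refine ((intervalIntegral_tendsto_integral_Ioi 1 (hd.mono_set (Ioi_subset_Ioi zero_le_one))
      tendsto_id).const_add (g 1)).congr' ?_
    filter_upwards [eventually_ge_atTop 1] with b hb
    simp only [id]
    rw [hftc 1 b one_pos hb]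
    ring
  have h2 : Tendsto g (𝓝[>] 0) (𝓝 (g 1 - ∫ r in (0 : ℝ)..1, deriv g r)) := by
    have h3 := (tendsto_intervalIntegral hd zero_le_one le_rfl).const_add (g 1)
    rw [intervalIntegral.integral_symm, ← sub_eq_add_neg] at h3
    refine h3.congr' ?_
    filter_upwards [Ioo_mem_nhdsGT (zero_lt_one : (0 : ℝ) < 1)] with a ha
    rw [intervalIntegral.integral_symm, hftc a 1 ha.1 ha.2.le]
    ring
  have h3 := tendsto_eq_zero_of_integrableOn_div (Ioi_mem_atTop 0)
    (tendsto_norm_atTop_atTop.comp Real.tendsto_log_atTop) hg h1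
  have h4 := tendsto_eq_zero_of_integrableOn_div self_mem_nhdsWithin
    (tendsto_abs_atBot_atTop.comp Real.tendsto_log_nhdsGT_zero) hg h2
  have h5 : ∫ r in Ioi (0 : ℝ), deriv g r =
      (∫ r in (0 : ℝ)..1, deriv g r) + ∫ r in Ioi (1 : ℝ), deriv g r := by
    rw [intervalIntegral.integral_of_le zero_le_one, ← setIntegral_union Ioc_disjoint_Ioi_same
      measurableSet_Ioi (hd.mono_set Ioc_subset_Ioi_self)
      (hd.mono_set (Ioi_subset_Ioi zero_le_one)), Ioc_union_Ioi_eq_Ioi zero_le_one]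
  linarith

namespace IsRadialH2

variable {φ ψ : ℝ → ℝ}

theorem isLocallyAC (h : IsRadialH2 φ) : IsLocallyAC φ :=
  isLocallyAC_of_hasDerivAt (fun r hr => (h.differentiableAt r hr).hasDerivAt)
    h.locallyAC_deriv.continuousOn

theorem tendsto_atTop (h : IsRadialH2 φ) : Tendsto φ atTop (𝓝 0) := by
  have hsub : Ioi (1 : ℝ) ⊆ Ioi 0 := Ioi_subset_Ioi zero_le_one
  -- on `(1, ∞)` the weight `r²` can be dropped
  have hdrop : ∀ f : ℝ → ℝ, ContinuousOn f (Ioi 0) →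
      IntegrableOn (fun r => r ^ 2 * f r) (Ioi 0) → IntegrableOn f (Ioi 1) := by
    intro f hf hi
    refine Integrable.mono (hi.mono_set hsub)
      ((hf.mono hsub).aestronglyMeasurable measurableSet_Ioi) ?_
    filter_upwards [ae_restrict_mem measurableSet_Ioi] with r hr
    have hr' : 1 < r := hr
    rw [norm_mul, Real.norm_of_nonneg (sq_nonneg r)]
    exact le_mul_of_one_le_left (norm_nonneg _) (by nlinarith)
  have hc := h.isLocallyAC.continuousOn
  have hc' := h.locallyAC_deriv.continuousOn
  have h1 : IntegrableOn (fun r => φ r * φ r) (Ioi 1) :=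
    hdrop _ (hc.mul hc) (h.memL2.integrableOn_mul h.memL2)
  have h2 : IntegrableOn (fun r => deriv φ r * φ r) (Ioi 1) :=
    hdrop _ (hc'.mul hc) (h.memL2_deriv.integrableOn_mul h.memL2)
  have h3 : IntegrableOn (fun r => deriv φ r * φ r + φ r * deriv φ r) (Ioi 1) := by
    refine h2.add (h2.congr (ae_of_all _ fun r => mul_comm _ _))
  have h4 := tendsto_zero_of_hasDerivAt_of_integrableOn_Ioi (fun r hr =>
    ((h.differentiableAt r (hsub hr)).hasDerivAt.fun_mul
      (h.differentiableAt r (hsub hr)).hasDerivAt)) h3 h1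
  have h5 : Tendsto (fun r => |φ r|) atTop (𝓝 0) := by
    have := (Real.continuous_sqrt.tendsto 0).comp h4
    rw [Real.sqrt_zero] at this
    exact this.congr fun r => Real.sqrt_mul_self_eq_abs (φ r)
  exact (tendsto_zero_iff_abs_tendsto_zero φ).2 h5

theorem mem_radialHDot1 (h : IsRadialH2 φ) : φ ∈ radialHDot1 :=
  ⟨h.eq_zero, h.isLocallyAC, h.memL2_deriv, h.tendsto_atTop⟩

theorem isRadialL2_radialLaplacian (h : IsRadialH2 φ) : IsRadialL2 (radialLaplacian φ) := by
  refine (MemLp.add h.memL2_deriv_deriv (MemLp.const_mul h.memL2_deriv_div 2)).ae_eq ?_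
  refine ae_of_all _ fun r => ?_
  simp only [Pi.add_apply, radialLaplacian]
  ring

/-- Green's first identity on radial functions. -/
theorem integral_deriv_mul_deriv (hφ : IsRadialH2 φ) (hψ : IsRadialH2 ψ) :
    ∫ r in Ioi (0 : ℝ), r ^ 2 * (deriv φ r * deriv ψ r) =
      -∫ r in Ioi (0 : ℝ), r ^ 2 * (radialLaplacian φ r * ψ r) := by
  have hsq : IsLocallyAC (fun r : ℝ => r ^ 2) :=
    isLocallyAC_of_hasDerivAt (fun r _ => hasDerivAt_pow 2 r) (by fun_prop)
  set g : ℝ → ℝ := fun r => r ^ 2 * deriv φ r * ψ r with hg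
  have hac : IsLocallyAC g := (hsq.mul hφ.locallyAC_deriv).mul hψ.isLocallyAC
  have hi1 := hφ.memL2_deriv.integrableOn_mul hψ.memL2_deriv
  have hi2 := hφ.isRadialL2_radialLaplacian.integrableOn_mul hψ.memL2
  have hderiv : (fun r => r ^ 2 * (deriv φ r * deriv ψ r) + r ^ 2 * (radialLaplacian φ r * ψ r))
      =ᵐ[volume.restrict (Ioi 0)] deriv g := by
    filter_upwards [hφ.locallyAC_deriv.ae_differentiableAt, ae_restrict_mem measurableSet_Ioi]
      with r hr hr0
    have hr0' : r ≠ 0 := ne_of_gt hr0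
    have h1 : deriv g r = _ := (((hasDerivAt_pow 2 r).mul hr.hasDerivAt).mul
      (hψ.differentiableAt r hr0).hasDerivAt).deriv
    rw [h1]
    unfold radialLaplacian
    simp
    field_simp
    ring
  have hgi : IntegrableOn (fun r => g r / r) (Ioi 0) := by
    refine (hφ.memL2_deriv_div.integrableOn_mul hψ.memL2).congr ?_
    filter_upwards [ae_restrict_mem measurableSet_Ioi] with r hr0
    have hr0' : r ≠ 0 := ne_of_gt hr0
    simp only [hg]
    field_simp
  have h1 := integral_deriv_eq_zero hac ((hi1.add hi2).congr hderiv) hgi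
  rw [← integral_congr_ae hderiv, integral_add hi1 hi2] at h1
  linarith

end IsRadialH2

theorem eq_zero_of_integral_sq_le_zero {φ : ℝ → ℝ} (h0 : ∀ r ≤ 0, φ r = 0)
    (hc : ContinuousOn φ (Ioi 0)) (hL2 : IsRadialL2 φ)
    (hle : ∫ r in Ioi (0 : ℝ), r ^ 2 * φ r ^ 2 ≤ 0) : φ = 0 := by
  have h1 : ∫ r in Ioi (0 : ℝ), r ^ 2 * φ r ^ 2 = 0 :=
    le_antisymm hle (integral_nonneg fun r => by positivity)
  rw [integral_eq_zero_iff_of_nonneg (fun r => by positivity) hL2.integrableOn_sq] at h1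
  have h2 : φ =ᵐ[volume.restrict (Ioi 0)] fun _ => 0 := by
    filter_upwards [h1, ae_restrict_mem measurableSet_Ioi] with r hr hr0
    have hr0' : r ≠ 0 := ne_of_gt hr0
    simpa [hr0'] using hr
  have h3 := Measure.eqOn_open_of_ae_eq h2 isOpen_Ioi hc continuousOn_const
  funext r
  rcases le_or_gt r 0 with hr | hr
  · exact h0 r hr
  · exact h3 hr

theorem IsRadialH2.integral_sq_pos {φ : ℝ → ℝ} (h : IsRadialH2 φ) (h0 : φ ≠ 0) :
    0 < ∫ r in Ioi (0 : ℝ), r ^ 2 * (φ r * φ r) := by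
  by_contra hle
  refine h0 (eq_zero_of_integral_sq_le_zero h.eq_zero h.isLocallyAC.continuousOn h.memL2 ?_)
  simpa only [sq] using not_lt.1 hle

/-! ### The eigenfunction obtained by shooting -/

theorem hasDerivAt_ite_le {f f' g g' : ℝ → ℝ} {R : ℝ}
    (hf : ∀ t ∈ Icc 0 R, HasDerivWithinAt f (f' t) (Icc 0 R) t)
    (hg : ∀ t, HasDerivAt g (g' t) t) (h0 : f R = g R) (h1 : f' R = g' R) {r : ℝ} (hr : 0 < r) :
    HasDerivAt (fun r => if r ≤ R then f r else g r) (if r ≤ R then f' r else g' r) r := by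
  rcases lt_trichotomy r R with h | rfl | h
  · rw [if_pos h.le]
    refine ((hf r ⟨hr.le, h.le⟩).hasDerivAt (Icc_mem_nhds hr h)).congr_of_eventuallyEq ?_
    filter_upwards [Iio_mem_nhds h] with s hs
    exact if_pos (le_of_lt hs)
  · rw [if_pos le_rfl]
    have hl : HasDerivWithinAt (fun s => if s ≤ r then f s else g s) (f' r) (Icc 0 r) r :=
      (hf r (right_mem_Icc.2 hr.le)).congr_of_mem (fun s hs => if_pos hs.2) (right_mem_Icc.2 hr.le)
    have hu : HasDerivWithinAt (fun s => if s ≤ r then f s else g s) (f' r) (Ici r) r := by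
      rw [h1]
      refine (hg r).hasDerivWithinAt.congr_of_mem (fun s hs => ?_) self_mem_Ici
      rcases eq_or_lt_of_le (mem_Ici.1 hs) with rfl | hs'
      · rw [if_pos le_rfl, h0]
      · exact if_neg (not_le.2 hs')
    refine (hl.union hu).hasDerivAt ?_
    rw [Icc_union_Ici_eq_Ici hr.le]
    exact Ici_mem_nhds hr
  · rw [if_neg (not_le.2 h)]
    refine (hg r).congr_of_eventuallyEq ?_
    filter_upwards [Ioi_mem_nhds h] with s hs
    exact if_neg (not_le.2 hs)

theorem memLp_two_of_exp_decay {f : ℝ → ℝ} {A B R κ : ℝ} (hκ : 0 < κ)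
    (hf : ContinuousOn f (Ioi 0)) (hA : ∀ r ∈ Ioc 0 R, |f r| ≤ A)
    (hB : ∀ r, R < r → |f r| ≤ B * Real.exp (-(κ * (r - R)))) :
    MemLp f 2 (volume.restrict (Ioi 0)) := by
  have hg : MemLp (fun r => (|A| + |B|) * Real.exp (κ * R) * Real.exp (-κ * r)) 2
      (volume.restrict (Ioi 0)) := by
    refine MemLp.const_mul ?_ _
    rw [memLp_two_iff_integrable_sq (by fun_prop)]
    refine (exp_neg_integrableOn_Ioi 0 (b := 2 * κ) (by positivity)).congr
      (ae_of_all _ fun r => ?_)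
    simp only
    rw [← Real.exp_nat_mul]
    congr 1
    push_cast
    ring
  refine hg.mono (hf.aestronglyMeasurable measurableSet_Ioi) ?_
  filter_upwards [ae_restrict_mem measurableSet_Ioi] with r hr
  have hexp : Real.exp (κ * R) * Real.exp (-κ * r) = Real.exp (-(κ * (r - R))) := by
    rw [← Real.exp_add]
    congr 1
    ring
  rw [mul_assoc, hexp, Real.norm_eq_abs, Real.norm_of_nonneg (by positivity)]
  rcases le_or_gt r R with h | h
  · have h1 : 1 ≤ Real.exp (-(κ * (r - R))) := Real.one_le_exp (by nlinarith)
    calc |f r| ≤ A := hA r ⟨hr, h⟩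
      _ ≤ |A| + |B| := by linarith [le_abs_self A, abs_nonneg B]
      _ ≤ _ := le_mul_of_one_le_right (by positivity) h1
  · refine (hB r h).trans ?_
    gcongr
    linarith [le_abs_self B, abs_nonneg A]

/-- The solution `u` on `[0, R]`, continued by a decaying exponential. -/
def decayExtension (R κ : ℝ) (u : ℝ → ℝ) (r : ℝ) : ℝ :=
  if r ≤ R then u r else u R * Real.exp (-(κ * (r - R)))

/-- The radial profile `U / r`, normalized to be zero for `r ≤ 0`. -/
def radialProfile (U : ℝ → ℝ) (r : ℝ) : ℝ := if r ≤ 0 then 0 else U r / r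

theorem radialProfile_of_pos (U : ℝ → ℝ) {r : ℝ} (hr : 0 < r) : radialProfile U r = U r / r :=
  if_neg (not_le.2 hr)

theorem hasDerivAt_radialProfile {U W : ℝ → ℝ} (hU : ∀ r, 0 < r → HasDerivAt U (W r) r) {r : ℝ}
    (hr : 0 < r) : HasDerivAt (radialProfile U) ((r * W r - U r) / r ^ 2) r := by
  refine (((hU r hr).div (hasDerivAt_id r) hr.ne').congr_of_eventuallyEq ?_).congr_deriv ?_
  · filter_upwards [Ioi_mem_nhds hr] with s hs
    rw [radialProfile_of_pos U hs]
    rfl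
  · simp only [id]
    ring

theorem hasDerivAt_deriv_radialProfile {U W X : ℝ → ℝ} (hU : ∀ r, 0 < r → HasDerivAt U (W r) r)
    (hW : ∀ r, 0 < r → HasDerivAt W (X r) r) {r : ℝ} (hr : 0 < r) :
    HasDerivAt (deriv (radialProfile U)) ((X r - 2 * ((r * W r - U r) / r ^ 2)) / r) r := by
  refine (((((hasDerivAt_id r).mul (hW r hr)).sub (hU r hr)).div (hasDerivAt_pow 2 r)
    (pow_ne_zero 2 hr.ne')).congr_of_eventuallyEq ?_).congr_deriv ?_
  · filter_upwards [Ioi_mem_nhds hr] with s hs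
    rw [(hasDerivAt_radialProfile hU hs).deriv]
    rfl
  · simp only [id]
    simp
    field_simp

theorem isRadialH2_radialProfile_of_memLp {U W X : ℝ → ℝ}
    (hU : ∀ r, 0 < r → HasDerivAt U (W r) r) (hW : ∀ r, 0 < r → HasDerivAt W (X r) r)
    (hXc : ContinuousOn X (Ioi 0)) (hUL2 : MemLp U 2 (volume.restrict (Ioi 0)))
    (hψL2 : MemLp (fun r => W r - U r / r) 2 (volume.restrict (Ioi 0)))
    (hdL2 : MemLp (fun r => (r * W r - U r) / r ^ 2) 2 (volume.restrict (Ioi 0)))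
    (hXL2 : MemLp X 2 (volume.restrict (Ioi 0))) : IsRadialH2 (radialProfile U) := by
  have hUc : ContinuousOn U (Ioi 0) := fun r hr => (hU r hr).continuousAt.continuousWithinAt
  have hWc : ContinuousOn W (Ioi 0) := fun r hr => (hW r hr).continuousAt.continuousWithinAt
  have hne : ∀ r ∈ Ioi (0 : ℝ), r ≠ 0 := fun r hr => ne_of_gt hr
  have hψ : ∀ r, 0 < r → HasDerivAt (radialProfile U) ((r * W r - U r) / r ^ 2) r :=
    fun r hr => hasDerivAt_radialProfile hU hr
  have hψ' : ∀ r, 0 < r → HasDerivAt (deriv (radialProfile U))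
      ((X r - 2 * ((r * W r - U r) / r ^ 2)) / r) r :=
    fun r hr => hasDerivAt_deriv_radialProfile hU hW hr
  have hdc : ContinuousOn (fun r => (r * W r - U r) / r ^ 2) (Ioi 0) :=
    ((continuousOn_id.mul hWc).sub hUc).div (continuousOn_id.pow 2)
      fun r hr => pow_ne_zero 2 (hne r hr)
  have hψc : ContinuousOn (fun r => (X r - 2 * ((r * W r - U r) / r ^ 2)) / r) (Ioi 0) :=
    (hXc.sub (continuousOn_const.mul hdc)).div continuousOn_id hne
  refine
    { eq_zero := fun r hr => if_pos hr
      differentiableAt := fun r hr => (hψ r hr).differentiableAt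
      locallyAC_deriv := isLocallyAC_of_hasDerivAt hψ' hψc
      memL2 := hUL2.ae_eq ?_
      memL2_deriv := hψL2.ae_eq ?_
      memL2_deriv_div := hdL2.ae_eq ?_
      memL2_deriv_deriv := (hXL2.sub (hdL2.const_mul 2)).ae_eq ?_ }
  · filter_upwards [ae_restrict_mem measurableSet_Ioi] with r hr
    rw [radialProfile_of_pos U hr, mul_div_cancel₀ _ (hne r hr)]
  · filter_upwards [ae_restrict_mem measurableSet_Ioi] with r hr
    have hr0 := hne r hr
    rw [(hψ r hr).deriv]
    field_simp
  · filter_upwards [ae_restrict_mem measurableSet_Ioi] with r hr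
    have hr0 := hne r hr
    rw [(hψ r hr).deriv]
    field_simp
  · filter_upwards [ae_restrict_mem measurableSet_Ioi] with r hr
    have hr0 := hne r hr
    rw [(hψ' r hr).deriv, mul_div_cancel₀ _ hr0]
    rfl

/-- With `W = U'`, the three functions are `r φ`, `r φ'` and `φ'` for `φ = U / r`. -/
theorem memLp_of_origin_bound {U W : ℝ → ℝ} {R κ B a b : ℝ} (hR : 0 < R) (hκ : 0 < κ)
    (hUc : ContinuousOn U (Ioi 0)) (hWc : ContinuousOn W (Ioi 0))
    (hin : ∀ r ∈ Icc 0 R, |U r| ≤ B * r ∧ |W r| ≤ B ∧ |r * W r - U r| ≤ B * r ^ 3)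
    (hU : ∀ r, R < r → U r = a * Real.exp (-(κ * (r - R))))
    (hW : ∀ r, R < r → W r = b * Real.exp (-(κ * (r - R)))) :
    MemLp U 2 (volume.restrict (Ioi 0)) ∧
      MemLp (fun r => W r - U r / r) 2 (volume.restrict (Ioi 0)) ∧
      MemLp (fun r => (r * W r - U r) / r ^ 2) 2 (volume.restrict (Ioi 0)) := by
  have hne : ∀ r ∈ Ioi (0 : ℝ), r ≠ 0 := fun r hr => ne_of_gt hr
  have hB0 : 0 ≤ B := (abs_nonneg _).trans (hin 0 (left_mem_Icc.2 hR.le)).2.1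
  refine ⟨?_, ?_, ?_⟩
  · refine memLp_two_of_exp_decay (A := B * R) (B := |a|) (R := R) hκ hUc
      (fun r hr => ?_) (fun r hr => ?_)
    · exact (hin r (Ioc_subset_Icc_self hr)).1.trans (mul_le_mul_of_nonneg_left hr.2 hB0)
    · rw [hU r hr, abs_mul, abs_of_pos (Real.exp_pos _)]
  · refine memLp_two_of_exp_decay (A := B + B) (B := |b| + |a| / R) (R := R) hκ
      (hWc.sub (hUc.div continuousOn_id hne)) (fun r hr => ?_) (fun r hr => ?_)
    · obtain ⟨h1, h2, -⟩ := hin r (Ioc_subset_Icc_self hr)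
      refine (abs_sub _ _).trans (add_le_add h2 ?_)
      rw [abs_div, abs_of_pos hr.1, div_le_iff₀ hr.1]
      exact h1
    · have hr0 : 0 < r := hR.trans hr
      rw [hU r hr, hW r hr]
      have he0 := Real.exp_pos (-(κ * (r - R)))
      generalize Real.exp (-(κ * (r - R))) = e at he0 ⊢
      have h1 : b * e - a * e / r = (b - a / r) * e := by
        field_simp
      rw [h1, abs_mul, abs_of_pos he0]
      refine mul_le_mul_of_nonneg_right ((abs_sub _ _).trans ?_) he0.le
      rw [abs_div, abs_of_pos hr0]
      gcongr
  · refine memLp_two_of_exp_decay (A := B * R) (B := |b| / R + |a| / R ^ 2) (R := R) hκ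
      (((continuousOn_id.mul hWc).sub hUc).div (continuousOn_id.pow 2)
        fun r hr => pow_ne_zero 2 (hne r hr)) (fun r hr => ?_) (fun r hr => ?_)
    · have hr0 := hr.1
      rw [abs_div, abs_of_nonneg (sq_nonneg r), div_le_iff₀ (by positivity)]
      refine (hin r (Ioc_subset_Icc_self hr)).2.2.trans ?_
      have h1 : B * r ≤ B * R := mul_le_mul_of_nonneg_left hr.2 hB0
      calc B * r ^ 3 = B * r * r ^ 2 := by ring
        _ ≤ _ := mul_le_mul_of_nonneg_right h1 (sq_nonneg r)
    · have hr0 : 0 < r := hR.trans hr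
      rw [hU r hr, hW r hr]
      have he0 := Real.exp_pos (-(κ * (r - R)))
      generalize Real.exp (-(κ * (r - R))) = e at he0 ⊢
      have h1 : (r * (b * e) - a * e) / r ^ 2 = (b / r - a / r ^ 2) * e := by
        field_simp
      rw [h1, abs_mul, abs_of_pos he0]
      refine mul_le_mul_of_nonneg_right ((abs_sub _ _).trans ?_) he0.le
      rw [abs_div, abs_div, abs_of_pos hr0, abs_of_nonneg (sq_nonneg r)]
      gcongr

theorem exists_abs_le_of_eq_zero {q : ℝ → ℝ} {R : ℝ} (hR : 0 ≤ R) (hqc : ContinuousOn q (Ici 0))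
    (hq : ∀ r, R ≤ r → q r = 0) : ∃ A, ∀ r, 0 ≤ r → |q r| ≤ A := by
  obtain ⟨A, hA⟩ := isCompact_Icc.exists_bound_of_continuousOn
    (hqc.mono (Icc_subset_Ici_self : Icc 0 R ⊆ Ici 0))
  refine ⟨A, fun r hr => ?_⟩
  rcases le_or_gt r R with h | h
  · exact hA r ⟨hr, h⟩
  · rw [hq r h.le, abs_zero]
    exact (norm_nonneg _).trans (hA 0 (left_mem_Icc.2 hR))

namespace IsRegularSolution

variable {q : ℝ → ℝ} {R s κ E : ℝ} {u v : ℝ → ℝ}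

theorem hasDerivAt_decayExtension (h : IsRegularSolution q R s (κ ^ 2) u v)
    (hm : v R = -(κ * u R)) {r : ℝ} (hr : 0 < r) :
    HasDerivAt (decayExtension R κ u) (decayExtension R κ v r) r := by
  have hg : ∀ t, HasDerivAt (fun t => u R * Real.exp (-(κ * (t - R))))
      (v R * Real.exp (-(κ * (t - R)))) t := by
    intro t
    refine ((((((hasDerivAt_id t).sub_const R).const_mul κ).neg).exp).const_mul
      (u R)).congr_deriv ?_
    rw [hm]
    simp
    ring
  exact hasDerivAt_ite_le h.hasDerivWithinAt hg (by simp) (by simp) hr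

theorem hasDerivAt_decayExtension_deriv (h : IsRegularSolution q R s (κ ^ 2) u v)
    (hm : v R = -(κ * u R)) (hq : ∀ r, R ≤ r → q r = 0) {r : ℝ} (hr : 0 < r) :
    HasDerivAt (decayExtension R κ v) ((κ ^ 2 - q r) * decayExtension R κ u r) r := by
  have hg : ∀ t, HasDerivAt (fun t => v R * Real.exp (-(κ * (t - R))))
      (κ ^ 2 * (u R * Real.exp (-(κ * (t - R))))) t := by
    intro t
    refine ((((((hasDerivAt_id t).sub_const R).const_mul κ).neg).exp).const_mul
      (v R)).congr_deriv ?_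
    rw [hm]
    simp
    ring
  refine (hasDerivAt_ite_le h.hasDerivWithinAt_deriv hg (by simp) (by simp [hq R le_rfl])
    hr).congr_deriv ?_
  unfold decayExtension
  split_ifs with h1
  · rfl
  · rw [hq r (le_of_lt (not_le.1 h1)), sub_zero]

/-- Near the origin, `u = O(r)` and `r u' - u = O(r³)`. -/
theorem exists_origin_bound (h : IsRegularSolution q R s E u v) (hR : 0 ≤ R)
    (hqc : ContinuousOn q (Icc 0 R)) :
    ∃ B, ∀ r ∈ Icc 0 R, |u r| ≤ B * r ∧ |v r| ≤ B ∧ |r * v r - u r| ≤ B * r ^ 3 := by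
  obtain ⟨B, hB⟩ := isCompact_Icc.exists_bound_of_continuousOn h.continuousOn_deriv
  obtain ⟨A, hA⟩ := isCompact_Icc.exists_bound_of_continuousOn
    ((continuousOn_const.sub hqc) : ContinuousOn (fun t => E - q t) (Icc 0 R))
  have hA0 : 0 ≤ A := (norm_nonneg _).trans (hA 0 (left_mem_Icc.2 hR))
  have hB0 : 0 ≤ B := (norm_nonneg _).trans (hB 0 (left_mem_Icc.2 hR))
  have hu : ∀ r ∈ Icc 0 R, |u r| ≤ B * r := by
    intro r hr
    have := norm_image_sub_le_of_norm_deriv_le_segment' h.hasDerivWithinAt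
      (fun t ht => hB t (Ico_subset_Icc_self ht)) r hr
    simpa [h.apply_zero] using this
  have hn : ∀ r ∈ Icc 0 R, |r * v r - u r| ≤ r * (A * (B * r)) * r := by
    intro r hr
    have hsub : Icc 0 r ⊆ Icc 0 R := Icc_subset_Icc_right hr.2
    have := norm_image_sub_le_of_norm_deriv_le_segment' (f := fun t => t * v t - u t)
      (f' := fun t => t * ((E - q t) * u t)) (C := r * (A * (B * r))) (a := 0) (b := r)
      (fun t ht => ?_) (fun t ht => ?_) r (right_mem_Icc.2 hr.1)
    · simpa [h.apply_zero] using this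
    · refine ((((hasDerivWithinAt_id t _).mul ((h.hasDerivWithinAt_deriv t (hsub ht)).mono
        hsub)).sub ((h.hasDerivWithinAt t (hsub ht)).mono hsub))).congr_deriv ?_
      simp only [id]
      ring
    · have ht' := hsub (Ico_subset_Icc_self ht)
      rw [Real.norm_eq_abs, abs_mul, abs_mul, abs_of_nonneg ht.1]
      have h1 : |u t| ≤ B * r := (hu t ht').trans (mul_le_mul_of_nonneg_left ht.2.le hB0)
      exact mul_le_mul ht.2.le (mul_le_mul (hA t ht') h1 (abs_nonneg _) hA0)
        (by positivity) hr.1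
  refine ⟨max B (A * B), fun r hr => ⟨(hu r hr).trans ?_, (hB r hr).trans (le_max_left _ _),
    (hn r hr).trans ?_⟩⟩
  · exact mul_le_mul_of_nonneg_right (le_max_left _ _) hr.1
  · rw [show r * (A * (B * r)) * r = A * B * r ^ 3 by ring]
    exact mul_le_mul_of_nonneg_right (le_max_right _ _) (pow_nonneg hr.1 3)

/-- A solution that matches a decaying exponential at `R` yields a radial `H²` function. -/
theorem isRadialH2_radialProfile (h : IsRegularSolution q R s (κ ^ 2) u v) (hR : 0 < R)
    (hκ : 0 < κ) (hm : v R = -(κ * u R)) (hq : ∀ r, R ≤ r → q r = 0)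
    (hqc : ContinuousOn q (Ici 0)) : IsRadialH2 (radialProfile (decayExtension R κ u)) := by
  have hU : ∀ r, 0 < r → HasDerivAt (decayExtension R κ u) (decayExtension R κ v r) r :=
    fun r hr => h.hasDerivAt_decayExtension hm hr
  have hW : ∀ r, 0 < r → HasDerivAt (decayExtension R κ v)
      ((κ ^ 2 - q r) * decayExtension R κ u r) r := fun r hr =>
    h.hasDerivAt_decayExtension_deriv hm hq hr
  have hUc : ContinuousOn (decayExtension R κ u) (Ioi 0) := fun r hr =>
    (hU r hr).continuousAt.continuousWithinAt
  have hWc : ContinuousOn (decayExtension R κ v) (Ioi 0) := fun r hr =>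
    (hW r hr).continuousAt.continuousWithinAt
  have hin : ∀ f : ℝ → ℝ, ∀ r ∈ Icc 0 R, decayExtension R κ f r = f r :=
    fun f r hr => if_pos hr.2
  have hout : ∀ f : ℝ → ℝ, ∀ r, R < r →
      decayExtension R κ f r = f R * Real.exp (-(κ * (r - R))) :=
    fun f r hr => if_neg (not_le.2 hr)
  obtain ⟨B, hB⟩ := h.exists_origin_bound hR.le (hqc.mono Icc_subset_Ici_self)
  obtain ⟨h1, h2, h3⟩ := memLp_of_origin_bound hR hκ hUc hWc
    (fun r hr => by rw [hin u r hr, hin v r hr]; exact hB r hr) (hout u) (hout v)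
  have hqc' : ContinuousOn (fun r => κ ^ 2 - q r) (Ioi 0) :=
    continuousOn_const.sub (hqc.mono Ioi_subset_Ici_self)
  obtain ⟨A, hA⟩ := exists_abs_le_of_eq_zero hR.le hqc hq
  refine isRadialH2_radialProfile_of_memLp hU hW (hqc'.mul hUc) h1 h2 h3 ?_
  refine MemLp.of_le_mul (c := κ ^ 2 + A) h1
    ((hqc'.mul hUc).aestronglyMeasurable measurableSet_Ioi) ?_
  filter_upwards [ae_restrict_mem measurableSet_Ioi] with r hr
  rw [norm_mul]
  refine mul_le_mul_of_nonneg_right ((_root_.norm_sub_le _ _).trans ?_) (norm_nonneg _)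
  rw [Real.norm_of_nonneg (sq_nonneg κ)]
  exact add_le_add le_rfl (hA r (le_of_lt hr))

theorem radialLaplacian_radialProfile (h : IsRegularSolution q R s (κ ^ 2) u v)
    (hm : v R = -(κ * u R)) (hq : ∀ r, R ≤ r → q r = 0) {r : ℝ} (hr : 0 < r) :
    radialLaplacian (radialProfile (decayExtension R κ u)) r =
      (κ ^ 2 - q r) * radialProfile (decayExtension R κ u) r := by
  unfold radialLaplacian
  rw [(hasDerivAt_deriv_radialProfile (fun r hr => h.hasDerivAt_decayExtension hm hr)
    (fun r hr => h.hasDerivAt_decayExtension_deriv hm hq hr) hr).deriv,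
    (hasDerivAt_radialProfile (fun r hr => h.hasDerivAt_decayExtension hm hr) hr).deriv,
    radialProfile_of_pos _ hr]
  field_simp
  ring

theorem radialProfile_ne_zero (h : IsRegularSolution q R s (κ ^ 2) u v) (hR : 0 < R)
    (hs : s ≠ 0) : radialProfile (decayExtension R κ u) ≠ 0 := by
  intro h0
  -- `u` would vanish on `(0, R)`, contradicting `u'(0) = s`
  have h1 : ∀ t ∈ Ioo 0 R, u t = 0 := by
    intro t ht
    have h2 : radialProfile (decayExtension R κ u) t = 0 := congrFun h0 t
    rw [radialProfile_of_pos _ ht.1, decayExtension, if_pos ht.2.le] at h2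
    exact (div_eq_zero_iff.1 h2).resolve_right ht.1.ne'
  have h2 := (h.hasDerivWithinAt 0 (left_mem_Icc.2 hR.le)).mono_of_mem_nhdsWithin
    (Icc_mem_nhdsGE hR : Icc 0 R ∈ 𝓝[≥] 0)
  have h3 : HasDerivWithinAt u 0 (Ici 0) 0 := by
    refine (hasDerivWithinAt_const (0 : ℝ) (Ici 0) (0 : ℝ)).congr_of_eventuallyEq ?_ h.apply_zero
    filter_upwards [Ico_mem_nhdsGE hR] with t ht
    rcases eq_or_lt_of_le ht.1 with rfl | ht'
    · exact h.apply_zero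
    · exact h1 t ⟨ht', ht.2⟩
  have h4 := (uniqueDiffOn_Ici (0 : ℝ) 0 self_mem_Ici).eq_deriv _ h2 h3
  rw [h.deriv_zero] at h4
  exact hs h4

end IsRegularSolution

/-! ### The quadratic form -/

/-- The polarization `∫ r² φ' ψ' - ∫ r² q φ ψ` of the quadratic form of `-Δ - q`. -/
def polarForm (q φ ψ : ℝ → ℝ) : ℝ :=
  (∫ r in Ioi (0 : ℝ), r ^ 2 * (deriv φ r * deriv ψ r)) -
    ∫ r in Ioi (0 : ℝ), r ^ 2 * (q r * (φ r * ψ r))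

theorem linForm_eq_polarForm (P : ℝ → ℝ) (R : ℝ) (V φ : ℝ → ℝ) :
    linForm P R V φ = 4 * Real.pi * polarForm (linPotential P R V) φ φ := by
  unfold linForm polarForm
  simp only [sq, mul_sub]

theorem polarForm_comm (q φ ψ : ℝ → ℝ) : polarForm q φ ψ = polarForm q ψ φ := by
  unfold polarForm
  simp only [mul_comm (deriv φ _), mul_comm (φ _)]

theorem integral_add_add_const_mul {f g h : ℝ → ℝ} {s : Set ℝ} (hf : IntegrableOn f s)
    (hg : IntegrableOn g s) (hh : IntegrableOn h s) (a b c : ℝ) :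
    ∫ r in s, (a * f r + b * g r + c * h r) =
      a * (∫ r in s, f r) + b * (∫ r in s, g r) + c * ∫ r in s, h r := by
  have h1 : ∫ r in s, (a * f r + b * g r + c * h r) =
      (∫ r in s, (a * f r + b * g r)) + ∫ r in s, c * h r :=
    integral_add ((hf.const_mul a).add (hg.const_mul b)) (hh.const_mul c)
  have h2 : ∫ r in s, (a * f r + b * g r) = (∫ r in s, a * f r) + ∫ r in s, b * g r :=
    integral_add (hf.const_mul a) (hg.const_mul b)
  rw [h1, h2, integral_const_mul, integral_const_mul, integral_const_mul]

theorem integrableOn_potential_mul {q φ ψ : ℝ → ℝ} {A : ℝ} (hqc : ContinuousOn q (Ioi 0))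
    (hA : ∀ r, 0 ≤ r → |q r| ≤ A) (hφ : IsRadialL2 φ) (hψ : IsRadialL2 ψ) :
    IntegrableOn (fun r => r ^ 2 * (q r * (φ r * ψ r))) (Ioi 0) := by
  refine (Integrable.bdd_mul (c := A) (hφ.integrableOn_mul hψ)
    (hqc.aestronglyMeasurable measurableSet_Ioi) ?_).congr (ae_of_all _ fun r => ?_)
  · filter_upwards [ae_restrict_mem measurableSet_Ioi] with r hr
    exact hA r (le_of_lt hr)
  · simp only
    ring

theorem polarForm_add_smul {q φ ψ : ℝ → ℝ} {A : ℝ} (hqc : ContinuousOn q (Ioi 0))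
    (hA : ∀ r, 0 ≤ r → |q r| ≤ A) (hφ : IsRadialH2 φ) (hψ : IsRadialH2 ψ) (a b : ℝ) :
    polarForm q (a • φ + b • ψ) (a • φ + b • ψ) =
      a ^ 2 * polarForm q φ φ + 2 * (a * b) * polarForm q φ ψ + b ^ 2 * polarForm q ψ ψ := by
  have h1 : ∫ r in Ioi (0 : ℝ), r ^ 2 * (deriv (a • φ + b • ψ) r * deriv (a • φ + b • ψ) r) =
      ∫ r in Ioi (0 : ℝ), (a ^ 2 * (r ^ 2 * (deriv φ r * deriv φ r)) +
        2 * (a * b) * (r ^ 2 * (deriv φ r * deriv ψ r)) +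
        b ^ 2 * (r ^ 2 * (deriv ψ r * deriv ψ r))) := by
    refine setIntegral_congr_fun measurableSet_Ioi fun r hr => ?_
    have h2 : deriv (a • φ + b • ψ) r = a * deriv φ r + b * deriv ψ r :=
      (((hφ.differentiableAt r hr).hasDerivAt.const_smul a).add
        ((hψ.differentiableAt r hr).hasDerivAt.const_smul b)).deriv
    simp only [h2]
    ring
  have h3 : ∫ r in Ioi (0 : ℝ), r ^ 2 * (q r * ((a • φ + b • ψ) r * (a • φ + b • ψ) r)) =
      ∫ r in Ioi (0 : ℝ), (a ^ 2 * (r ^ 2 * (q r * (φ r * φ r))) +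
        2 * (a * b) * (r ^ 2 * (q r * (φ r * ψ r))) +
        b ^ 2 * (r ^ 2 * (q r * (ψ r * ψ r)))) := by
    refine setIntegral_congr_fun measurableSet_Ioi fun r _ => ?_
    simp only [Pi.add_apply, Pi.smul_apply, smul_eq_mul]
    ring
  unfold polarForm
  rw [h1, h3, integral_add_add_const_mul (hφ.memL2_deriv.integrableOn_mul hφ.memL2_deriv)
      (hφ.memL2_deriv.integrableOn_mul hψ.memL2_deriv)
      (hψ.memL2_deriv.integrableOn_mul hψ.memL2_deriv),
    integral_add_add_const_mul (integrableOn_potential_mul hqc hA hφ.memL2 hφ.memL2)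
      (integrableOn_potential_mul hqc hA hφ.memL2 hψ.memL2)
      (integrableOn_potential_mul hqc hA hψ.memL2 hψ.memL2)]
  ring

/-- A radial eigenfunction satisfies its eigenvalue equation weakly. -/
theorem polarForm_eq_of_eigenfunction {q φ ψ : ℝ → ℝ} {A lam : ℝ} (hqc : ContinuousOn q (Ioi 0))
    (hA : ∀ r, 0 ≤ r → |q r| ≤ A) (hφ : IsRadialH2 φ) (hψ : IsRadialH2 ψ)
    (heq : ∀ᵐ r ∂(volume.restrict (Ioi (0 : ℝ))), -radialLaplacian φ r - q r * φ r = lam * φ r) :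
    polarForm q φ ψ = lam * ∫ r in Ioi (0 : ℝ), r ^ 2 * (φ r * ψ r) := by
  unfold polarForm
  have h1 : ∫ r in Ioi (0 : ℝ), (-(r ^ 2 * (radialLaplacian φ r * ψ r)) -
      r ^ 2 * (q r * (φ r * ψ r))) = (∫ r in Ioi (0 : ℝ), -(r ^ 2 * (radialLaplacian φ r * ψ r))) -
      ∫ r in Ioi (0 : ℝ), r ^ 2 * (q r * (φ r * ψ r)) :=
    integral_sub (hφ.isRadialL2_radialLaplacian.integrableOn_mul hψ.memL2).neg
      (integrableOn_potential_mul hqc hA hφ.memL2 hψ.memL2)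
  rw [hφ.integral_deriv_mul_deriv hψ, ← integral_neg, ← h1, ← integral_const_mul]
  refine integral_congr_ae ?_
  filter_upwards [heq] with r hr
  linear_combination (r ^ 2 * ψ r) * hr

/-- Evaluation at a point kills at most one dimension: if `Q ≥ 0` on the functions in `X` that
vanish at `r₀` and `Q < 0` on a line in `X`, then `Q` has negative index one. -/
theorem negIndex_eq_one {X : Submodule ℝ (ℝ → ℝ)} {Q : (ℝ → ℝ) → ℝ} {r₀ : ℝ}
    (hnonneg : ∀ φ ∈ X, φ r₀ = 0 → 0 ≤ Q φ) {ψ : ℝ → ℝ} (hψ : ψ ∈ X) (hψ0 : ψ ≠ 0)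
    (hneg : ∀ c : ℝ, c ≠ 0 → Q (c • ψ) < 0) : negIndex X Q = 1 := by
  refine le_antisymm (sSup_le ?_) (le_sSup ?_)
  · rintro d ⟨N, hNX, hN, rfl⟩
    have hinj : Function.Injective ((LinearMap.proj r₀ : (ℝ → ℝ) →ₗ[ℝ] ℝ).comp N.subtype) := by
      rw [injective_iff_map_eq_zero]
      intro v hv
      by_contra hne
      have h1 := hN v v.2 (fun h => hne (Subtype.ext h))
      have h2 := hnonneg v (hNX v.2) hv
      linarith
    have h1 := LinearMap.rank_le_of_injective _ hinj
    rw [Module.rank_self] at h1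
    have h2 := Cardinal.toENat.monotone' h1
    simpa using h2
  · refine ⟨ℝ ∙ ψ, (Submodule.span_singleton_le_iff_mem ψ X).2 hψ, ?_, ?_⟩
    · intro v hv hv0
      obtain ⟨c, rfl⟩ := Submodule.mem_span_singleton.1 hv
      exact hneg c fun hc => hv0 (by rw [hc, zero_smul])
    · have h1 : Module.rank ℝ (ℝ ∙ ψ) = 1 := by
        exact Module.rank_eq_one_iff_finrank_eq_one.2 (finrank_span_singleton hψ0)
      rw [h1]
      simp

namespace IsEmdenProfile

variable {C α R : ℝ} {y z : ℝ → ℝ}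

/-- The zero-energy solution `r w`, with `w` the scaling generator, bends down at `R`. -/
theorem isRegularSolution_scaling (h : IsEmdenProfile C α R y z) :
    IsRegularSolution (emdenPotential C α y) R (2 / (α - 1) * y 0) 0
      (fun r => r * emdenScaling α y z r)
      (fun r => emdenScaling α y z r + emdenFlux C α y z r / r) := by
  set w := emdenScaling α y z with hw
  set p := emdenFlux C α y z with hp
  set q := emdenPotential C α y with hq
  have hw0 : w 0 = 2 / (α - 1) * y 0 := by simp [hw, emdenScaling]
  have hwlim : Tendsto w (𝓝[>] 0) (𝓝 (2 / (α - 1) * y 0)) := h.tendsto_emdenScaling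
  have hplim : Tendsto (fun r => p r / r) (𝓝[>] 0) (𝓝 0) := h.tendsto_emdenFlux_div
  have hqlim : Tendsto q (𝓝[>] 0) (𝓝 (q 0)) :=
    (h.continuousOn_emdenPotential 0 self_mem_Ici).mono Ioi_subset_Ici_self
  have hd1 : ∀ r, 0 < r → HasDerivAt (fun r => r * w r) (w r + p r / r) r := by
    intro r hr
    refine ((hasDerivAt_id r).mul (h.hasDerivAt_emdenScaling hr)).congr_deriv ?_
    simp only [id, ← hw, ← hp]
    field_simp
  have hd2 : ∀ r, 0 < r → HasDerivAt (fun r => w r + p r / r) ((0 - q r) * (r * w r)) r := by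
    intro r hr
    refine ((h.hasDerivAt_emdenScaling hr).add
      ((h.hasDerivAt_emdenFlux hr).div (hasDerivAt_id r) hr.ne')).congr_deriv ?_
    simp only [id]
    field_simp
    ring
  have hlim1 : Tendsto (fun r => r * w r) (𝓝[>] 0) (𝓝 0) := by
    simpa using tendsto_id_nhdsGT_zero.mul hwlim
  have hlim2 : Tendsto (fun r => w r + p r / r) (𝓝[>] 0) (𝓝 (2 / (α - 1) * y 0)) := by
    simpa using hwlim.add hplim
  refine ⟨by simp, by simp [hw0], fun t ht => ?_, fun t ht => ?_⟩
  · rcases eq_or_lt_of_le ht.1 with rfl | ht0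
    · refine HasDerivWithinAt.mono ?_ Icc_subset_Ici_self
      refine hasDerivWithinAt_Ici_of_tendsto_deriv (s := Ioi 0)
        (fun r hr => (hd1 r hr).differentiableAt.differentiableWithinAt) ?_ self_mem_nhdsWithin ?_
      · simpa [ContinuousWithinAt] using hlim1
      · simp only [div_zero, add_zero, hw0]
        refine hlim2.congr' ?_
        filter_upwards [self_mem_nhdsWithin] with r hr
        exact (hd1 r hr).deriv.symm
    · exact (hd1 t ht0).hasDerivWithinAt
  · rcases eq_or_lt_of_le ht.1 with rfl | ht0
    · refine HasDerivWithinAt.mono ?_ Icc_subset_Ici_self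
      refine hasDerivWithinAt_Ici_of_tendsto_deriv (s := Ioi 0)
        (fun r hr => (hd2 r hr).differentiableAt.differentiableWithinAt) ?_ self_mem_nhdsWithin ?_
      · simpa [ContinuousWithinAt, hw0] using hlim2
      · have h1 : Tendsto (fun r => (0 - q r) * (r * w r)) (𝓝[>] 0) (𝓝 ((0 - q 0) * 0)) :=
          (hqlim.const_sub 0).mul hlim1
        rw [zero_mul]
        refine h1.congr' ?_
        filter_upwards [self_mem_nhdsWithin] with r hr
        exact (hd2 r hr).deriv.symm
    · exact (hd2 t ht0).hasDerivWithinAt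

/-- The operator `-Δ - q` has a negative radial eigenvalue. -/
theorem exists_eigenfunction (h : IsEmdenProfile C α R y z) :
    ∃ lam < 0, ∃ ψ, IsRadialH2 ψ ∧ ψ ≠ 0 ∧ ∀ r, 0 < r →
      -radialLaplacian ψ r - emdenPotential C α y r * ψ r = lam * ψ r := by
  have hα : 0 < α - 1 := by linarith [h.one_lt]
  have hR := h.radius_pos
  have hs : 0 < 2 / (α - 1) * y 0 := mul_pos (by positivity) (h.pos_of_lt 0 le_rfl hR)
  have hneg : emdenScaling α y z R + emdenFlux C α y z R / R < 0 := by
    have h1 : emdenScaling α y z R + emdenFlux C α y z R / R = 2 / (α - 1) * (R * z R) := by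
      unfold emdenScaling emdenFlux
      rw [h.apply_radius, max_self, Real.zero_rpow (by linarith [h.one_lt])]
      field_simp
      ring
    rw [h1]
    exact mul_neg_of_pos_of_neg (by positivity) (mul_neg_of_pos_of_neg hR (h.deriv_neg R hR))
  have hqR : ∀ r, R ≤ r → emdenPotential C α y r = 0 := fun r hr => h.emdenPotential_eq_zero hr
  obtain ⟨κ, hκ, u, v, huv, hm⟩ := h.isRegularSolution_scaling.exists_matching hR hs
    (h.continuousOn_emdenPotential.mono Icc_subset_Ici_self) hneg
  refine ⟨-κ ^ 2, by nlinarith, radialProfile (decayExtension R κ u),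
    huv.isRadialH2_radialProfile hR hκ hm hqR h.continuousOn_emdenPotential,
    huv.radialProfile_ne_zero hR hs.ne', fun r hr => ?_⟩
  rw [huv.radialLaplacian_radialProfile hm hqR hr]
  ring

/-- The form of `-Δ - q` is nonnegative on the functions vanishing at the zero of the scaling
generator. -/
theorem exists_polarForm_nonneg (h : IsEmdenProfile C α R y z) :
    ∃ r₀, ∀ φ ∈ radialHDot1, φ r₀ = 0 → 0 ≤ polarForm (emdenPotential C α y) φ φ := by
  have hR := h.radius_pos
  obtain ⟨r₀, hr₀, hw₀, hp₀, hpos, hneg⟩ := h.exists_emdenScaling_zero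
  refine ⟨r₀, ?_⟩
  rintro φ ⟨-, hac, hd, hlim⟩ h0
  have hqc : ContinuousOn (emdenPotential C α y) (Ioi 0) :=
    h.continuousOn_emdenPotential.mono Ioi_subset_Ici_self
  obtain ⟨A, hA⟩ := exists_abs_le_of_eq_zero hR.le h.continuousOn_emdenPotential
    fun r hr => h.emdenPotential_eq_zero hr
  have hA0 : 0 ≤ A := (abs_nonneg _).trans (hA 0 le_rfl)
  have hi : IntegrableOn (fun r => r ^ 2 * (emdenPotential C α y r * φ r ^ 2)) (Ioi 0) := by
    rw [← Ioc_union_Ioi_eq_Ioi hR.le]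
    refine IntegrableOn.union ?_ ?_
    · set D := ∫ r in Ioi (0 : ℝ), r ^ 2 * deriv φ r ^ 2 with hD
      have hc : ContinuousOn (fun r => r ^ 2 * (emdenPotential C α y r * φ r ^ 2)) (Ioc 0 R) :=
        ((continuousOn_pow 2).mul (hqc.mul (hac.continuousOn.pow 2))).mono Ioc_subset_Ioi_self
      refine ⟨hc.aestronglyMeasurable measurableSet_Ioc,
        HasFiniteIntegral.restrict_of_bounded (C := R * (A * D)) measure_Ioc_lt_top ?_⟩
      filter_upwards [ae_restrict_mem measurableSet_Ioc] with r hr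
      have h1 := mul_sq_le_of_tendsto_zero hac hd hlim hr.1
      have h2 : 0 ≤ r * φ r ^ 2 := mul_nonneg hr.1.le (sq_nonneg _)
      rw [show r ^ 2 * (emdenPotential C α y r * φ r ^ 2) =
        r * (emdenPotential C α y r * (r * φ r ^ 2)) by ring, Real.norm_eq_abs, abs_mul, abs_mul,
        abs_of_pos hr.1, abs_of_nonneg h2]
      exact mul_le_mul hr.2 (mul_le_mul (hA r hr.1.le) h1 h2 hA0)
        (mul_nonneg (abs_nonneg _) h2) hR.le
    · refine (integrableOn_zero (s := Ioi R)).congr_fun (fun r hr => ?_) measurableSet_Ioi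
      rw [h.emdenPotential_eq_zero (le_of_lt hr)]
      simp
  have hα : 0 < α - 1 := by linarith [h.one_lt]
  have hk : 2 / (α - 1) * y 0 ≠ 0 :=
    (mul_pos (by positivity) (h.pos_of_lt 0 le_rfl hR)).ne'
  have hzero : Tendsto (fun r => emdenFlux C α y z r / r / emdenScaling α y z r)
      (𝓝[>] 0) (𝓝 0) := by
    have h1 := h.tendsto_emdenFlux_div.div h.tendsto_emdenScaling hk
    rw [zero_div] at h1
    exact h1
  have hinf : ∃ B, ∀ᶠ r in atTop, |emdenFlux C α y z r / emdenScaling α y z r| ≤ B := by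
    obtain ⟨c, hc, hc'⟩ := h.exists_emdenScaling_le
    refine ⟨|emdenFlux C α y z R| / c, ?_⟩
    filter_upwards [eventually_ge_atTop (R + 1)] with r hr
    have h1 := hc' r hr
    have h2 : emdenScaling α y z r < 0 := by linarith
    rw [h.emdenFlux_eq_of_le (by linarith), abs_div, abs_of_neg h2]
    exact div_le_div_of_nonneg_left (abs_nonneg _) hc (by linarith)
  have hfin := integral_potential_le_of_apply_eq_zero hr₀.1
    (fun r hr => h.hasDerivAt_emdenScaling hr) (fun r hr => h.hasDerivAt_emdenFlux hr) hqc hw₀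
    hp₀.ne (fun r hr hne => ?_) hzero hinf hac hd hlim hi h0
  · unfold polarForm
    simp only [← sq]
    linarith
  · rcases lt_or_gt_of_ne hne with h1 | h1
    · exact (hpos r ⟨hr, h1⟩).ne'
    · exact (hneg r h1).ne

end IsEmdenProfile

/-- Negative eigenvalues are unique and simple, because the combination of two independent
eigenfunctions that vanishes at `r₀` would make the form negative. -/
theorem eigenfunction_unique {q : ℝ → ℝ} {A r₀ : ℝ} (hqc : ContinuousOn q (Ioi 0))
    (hA : ∀ r, 0 ≤ r → |q r| ≤ A)
    (hnonneg : ∀ φ ∈ radialHDot1, φ r₀ = 0 → 0 ≤ polarForm q φ φ)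
    {lam lam' : ℝ} (hlam : lam < 0) (hlam' : lam' < 0) {φ ψ : ℝ → ℝ}
    (hφ : IsRadialH2 φ) (hψ : IsRadialH2 ψ) (hφ0 : φ ≠ 0) (hψ0 : ψ ≠ 0)
    (hφe : ∀ᵐ r ∂(volume.restrict (Ioi (0 : ℝ))), -radialLaplacian φ r - q r * φ r = lam' * φ r)
    (hψe : ∀ᵐ r ∂(volume.restrict (Ioi (0 : ℝ))), -radialLaplacian ψ r - q r * ψ r = lam * ψ r) :
    lam' = lam ∧ ∃ c : ℝ, φ = c • ψ := by
  have hNφ := hφ.integral_sq_pos hφ0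
  have hNψ := hψ.integral_sq_pos hψ0
  have e1 := polarForm_eq_of_eigenfunction hqc hA hφ hφ hφe
  have e2 := polarForm_eq_of_eigenfunction hqc hA hψ hψ hψe
  have e3 := polarForm_eq_of_eigenfunction hqc hA hφ hψ hφe
  have e4 := polarForm_eq_of_eigenfunction hqc hA hψ hφ hψe
  rw [polarForm_comm] at e4
  simp only [mul_comm (ψ _) (φ _)] at e4
  have hψr : ψ r₀ ≠ 0 := fun h0 => by
    have := hnonneg ψ hψ.mem_radialHDot1 h0
    rw [e2] at this
    nlinarith
  set a := ψ r₀ with ha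
  set b := -φ r₀ with hb
  have hχmem : a • φ + b • ψ ∈ radialHDot1 :=
    radialHDot1.add_mem (radialHDot1.smul_mem a hφ.mem_radialHDot1)
      (radialHDot1.smul_mem b hψ.mem_radialHDot1)
  have hχ := hnonneg _ hχmem (by simp [ha, hb]; ring)
  rw [polarForm_add_smul hqc hA hφ hψ, e1, e2] at hχ
  set Nφ := ∫ r in Ioi (0 : ℝ), r ^ 2 * (φ r * φ r) with hNφdef
  set Nψ := ∫ r in Ioi (0 : ℝ), r ^ 2 * (ψ r * ψ r) with hNψdef
  set S := ∫ r in Ioi (0 : ℝ), r ^ 2 * (φ r * ψ r) with hSdef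
  have ha2 : 0 < a ^ 2 := by positivity
  have hlameq : lam' = lam := by
    by_contra hne
    -- eigenfunctions for different eigenvalues are orthogonal
    have hS : S = 0 := by
      have h1 : (lam' - lam) * S = 0 := by linarith
      exact (mul_eq_zero.1 h1).resolve_left (sub_ne_zero.2 hne)
    rw [hS, mul_zero] at e3
    rw [e3] at hχ
    have h1 : a ^ 2 * (lam' * Nφ) < 0 :=
      mul_neg_of_pos_of_neg ha2 (mul_neg_of_neg_of_pos hlam' hNφ)
    have h2 : b ^ 2 * (lam * Nψ) ≤ 0 :=
      mul_nonpos_of_nonneg_of_nonpos (sq_nonneg b) (mul_neg_of_neg_of_pos hlam hNψ).le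
    linarith
  refine ⟨hlameq, ?_⟩
  rw [e3, hlameq] at hχ
  have hnorm : ∫ r in Ioi (0 : ℝ), r ^ 2 * (a • φ + b • ψ) r ^ 2 =
      a ^ 2 * Nφ + 2 * (a * b) * S + b ^ 2 * Nψ := by
    rw [hNφdef, hNψdef, hSdef, ← integral_add_add_const_mul
      (hφ.memL2.integrableOn_mul hφ.memL2) (hφ.memL2.integrableOn_mul hψ.memL2)
      (hψ.memL2.integrableOn_mul hψ.memL2)]
    refine integral_congr_ae (ae_of_all _ fun r => ?_)
    simp only [Pi.add_apply, Pi.smul_apply, smul_eq_mul]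
    ring
  have hL2 : IsRadialL2 (a • φ + b • ψ) := by
    refine (MemLp.add (hφ.memL2.const_mul a) (hψ.memL2.const_mul b)).ae_eq
      (ae_of_all _ fun r => ?_)
    simp only [Pi.add_apply, Pi.smul_apply, smul_eq_mul]
    ring
  have hzero : a • φ + b • ψ = 0 := by
    refine eq_zero_of_integral_sq_le_zero hχmem.1 hχmem.2.1.continuousOn hL2 ?_
    rw [hnorm]
    have h1 : 0 ≤ lam * (a ^ 2 * Nφ + 2 * (a * b) * S + b ^ 2 * Nψ) := by linarith
    exact nonpos_of_mul_nonneg_right h1 hlam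
  refine ⟨φ r₀ / ψ r₀, funext fun r => ?_⟩
  have h1 := congrFun hzero r
  simp only [Pi.add_apply, Pi.smul_apply, smul_eq_mul, Pi.zero_apply, ha, hb] at h1
  simp only [Pi.smul_apply, smul_eq_mul]
  rw [div_mul_eq_mul_div, eq_div_iff (show ψ r₀ ≠ 0 from hψr)]
  linarith

end EulerPoisson

end

theorem lemma3p8 (K γ : ℝ) (hK : 0 < K) (hγ : γ ∈ Set.Ioo (6 / 5 : ℝ) 2)
    (μ : ℝ) (hμ : 0 < μ) (R : ℝ) (ρ V : ℝ → ℝ)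
    (hstar : EulerPoisson.IsNonrotatingStar (EulerPoisson.polytrope K γ) μ R ρ V) :
    EulerPoisson.negIndex EulerPoisson.radialHDot1
        (EulerPoisson.linForm (EulerPoisson.polytrope K γ) R V) = 1 ∧
      ∃ lam : ℝ, lam < 0 ∧ ∃ ψ : ℝ → ℝ,
        EulerPoisson.IsEigenfunction (EulerPoisson.polytrope K γ) R V lam ψ ∧
        ∀ (lam' : ℝ) (φ : ℝ → ℝ), lam' < 0 →
          EulerPoisson.IsEigenfunction (EulerPoisson.polytrope K γ) R V lam' φ →
          lam' = lam ∧ ∃ c : ℝ, φ = c • ψ := by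
  have h := hstar.isEmdenProfile hK hγ
  have hpot : EulerPoisson.linPotential (EulerPoisson.polytrope K γ) R V =
      EulerPoisson.emdenPotential (4 * Real.pi * EulerPoisson.fplusCoeff K γ) (1 / (γ - 1))
        (fun r => V R - V r) := by
    funext r
    unfold EulerPoisson.linPotential EulerPoisson.emdenPotential
    rw [EulerPoisson.deriv_Fplus_polytrope hK ⟨by linarith [hγ.1], hγ.2⟩]
    ring
  obtain ⟨r₀, hnonneg⟩ := h.exists_polarForm_nonneg
  obtain ⟨lam, hlam, ψ, hψ, hψ0, hψe⟩ := h.exists_eigenfunction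
  have hqc := h.continuousOn_emdenPotential.mono Ioi_subset_Ici_self
  obtain ⟨A, hA⟩ := EulerPoisson.exists_abs_le_of_eq_zero h.radius_pos.le
    h.continuousOn_emdenPotential fun r hr => h.emdenPotential_eq_zero hr
  rw [← hpot] at hnonneg hψe hqc hA
  have hψae : ∀ᵐ r ∂(volume.restrict (Ioi (0 : ℝ))),
      -EulerPoisson.radialLaplacian ψ r -
        EulerPoisson.linPotential (EulerPoisson.polytrope K γ) R V r * ψ r = lam * ψ r :=
    (ae_restrict_mem measurableSet_Ioi).mono hψe
  refine ⟨EulerPoisson.negIndex_eq_one (r₀ := r₀) (fun φ hφ h0 => ?_) hψ.mem_radialHDot1 hψ0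
    (fun c hc => ?_), lam, hlam, ψ, ⟨hψ, hψ0, hψae⟩, fun lam' φ hlam' hφ => ?_⟩
  · rw [EulerPoisson.linForm_eq_polarForm]
    exact mul_nonneg (by positivity) (hnonneg φ hφ h0)
  · have h1 := EulerPoisson.polarForm_add_smul hqc hA hψ hψ c 0
    rw [zero_smul, add_zero, EulerPoisson.polarForm_eq_of_eigenfunction hqc hA hψ hψ hψae] at h1
    rw [EulerPoisson.linForm_eq_polarForm, h1]
    refine mul_neg_of_pos_of_neg (by positivity) ?_
    have h3 := mul_neg_of_pos_of_neg (by positivity : 0 < c ^ 2)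
      (mul_neg_of_neg_of_pos hlam (hψ.integral_sq_pos hψ0))
    linarith
  · exact EulerPoisson.eigenfunction_unique hqc hA hnonneg hlam hlam' hφ.1 hψ hφ.2.1 hψ0
      hφ.2.2 hψae
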